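/- Let $p > 3$ be a prime and let $E$ be a supersingular elliptic curve over an algebraic closure $\overline{\mathbb F}_p$ of $\mathbb F_p$, i.e. $E$ has no point of order $p$ over $\overline{\mathbb F}_p$. Say that $E$ is defined over $\mathbb F_p$ if $E$ is isomorphic over $\overline{\mathbb F}_p$ to an elliptic curve given by a Weierstrass equation with coefficients in $\mathbb F_p$, and let $\operatorname{End} E$ be the ring of all endomorphisms of $E$ over $\overline{\mathbb F}_p$ (morphisms of curves that are group homomorphisms, with pointwise addition and composition). Then $$E \text{ is defined over } \mathbb F_p \iff \mathbb Z[\sqrt{-p}] \subseteq \operatorname{End} E,$$ where the right-hand side means that there is an injective ring homomorphism $\mathbb Z[\sqrt{-p}] \to \operatorname{End} E$. -/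

import Mathlib

namespace EllCurve

open MvPolynomial

section Morphisms

variable {K : Type*} [Field K]

/-- Homogeneous coordinates `(X, Y, Z)` of a point of a Weierstrass curve: `(0, 1, 0)` for the point
at infinity and `(x, y, 1)` for an affine point `(x, y)`. -/
def coords {E : WeierstrassCurve K} : E.toAffine.Point → Fin 3 → K
  | .zero => ![0, 1, 0]
  | .some x y _ => ![x, y, 1]

/-- A map from the points of `E` to the points of `E'` is regular at `P` if there are three
homogeneous polynomials of the same degree, not all vanishing at `P`, such that for every point `Q`
at which they do not all vanish, their values at `Q` are homogeneous coordinates of `φ Q`.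
(In the last clause `c = 0` means exactly that all three vanish at `Q`.) -/
def IsRegularAt {E E' : WeierstrassCurve K} (φ : E.toAffine.Point → E'.toAffine.Point)
    (P : E.toAffine.Point) : Prop :=
  ∃ (d : ℕ) (F : Fin 3 → MvPolynomial (Fin 3) K), (∀ i, (F i).IsHomogeneous d) ∧
    (∃ i, eval (coords P) (F i) ≠ 0) ∧
    ∀ Q, ∃ c : K, (fun i => eval (coords Q) (F i)) = c • coords (φ Q)

/-- A morphism of projective curves, given on points over the algebraically closed base field. -/
def IsMorphism {E E' : WeierstrassCurve K} (φ : E.toAffine.Point → E'.toAffine.Point) : Prop :=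
  ∀ P, IsRegularAt φ P

variable {E : WeierstrassCurve K}

theorem coords_ne_zero (P : E.toAffine.Point) : ∃ i, coords P i ≠ 0 := by
  cases P with
  | zero => exact ⟨1, by simp [coords]⟩
  | some x y h => exact ⟨2, by simp [coords]⟩

theorem coords_equation (P : E.toAffine.Point) : E.toProjective.Equation (coords P) := by
  cases P with
  | zero => exact WeierstrassCurve.Projective.equation_zero
  | some x y h => exact (WeierstrassCurve.Projective.equation_some x y).mpr h.1

theorem isRegularAt_const {E' : WeierstrassCurve K} (T : E'.toAffine.Point)
    (P : E.toAffine.Point) : IsRegularAt (fun _ => T) P := by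
  refine ⟨0, fun i => C (coords T i), fun i => isHomogeneous_C _ _, ?_, fun Q => ⟨1, ?_⟩⟩
  · simpa using coords_ne_zero T
  · simp

theorem isRegularAt_id (P : E.toAffine.Point) : IsRegularAt (fun Q => Q) P := by
  refine ⟨1, fun i => X i, fun i => isHomogeneous_X _ _, ?_, fun Q => ⟨1, ?_⟩⟩
  · simpa using coords_ne_zero P
  · simp

theorem IsRegularAt.ne_zero {E E' : WeierstrassCurve K} {c : K} {Q : E.toAffine.Point}
    {F : Fin 3 → MvPolynomial (Fin 3) K} {R : E'.toAffine.Point}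
    (h : ∃ i, eval (coords Q) (F i) ≠ 0)
    (hc : (fun i => eval (coords Q) (F i)) = c • coords R) : c ≠ 0 := by
  rintro rfl
  obtain ⟨i, hi⟩ := h
  exact hi (by simpa using congrFun hc i)

theorem eval_smul_of_homogeneous {f : MvPolynomial (Fin 3) K} {d : ℕ} (hf : f.IsHomogeneous d)
    (c : K) (v : Fin 3 → K) : eval (c • v) f = c ^ d * eval v f := by
  rw [eval_eq, eval_eq, Finset.mul_sum]
  refine Finset.sum_congr rfl fun m hm => ?_
  have hd := hf.degree_eq_sum_deg_support hm
  simp only [Pi.smul_apply, smul_eq_mul, mul_pow, Finset.prod_mul_distrib, Finset.prod_pow_eq_pow_sum]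
  rw [← hd]
  ring

theorem IsRegularAt.comp {E₁ E₂ E₃ : WeierstrassCurve K}
    {ψ : E₂.toAffine.Point → E₃.toAffine.Point} {φ : E₁.toAffine.Point → E₂.toAffine.Point}
    {P : E₁.toAffine.Point} (hψ : IsRegularAt ψ (φ P)) (hφ : IsRegularAt φ P) :
    IsRegularAt (fun Q => ψ (φ Q)) P := by
  obtain ⟨d, F, hF, hFP, hFQ⟩ := hφ
  obtain ⟨e, G, hG, hGP, hGQ⟩ := hψ
  have key : ∀ (Q : E₁.toAffine.Point) (c : K),
      (fun i => eval (coords Q) (F i)) = c • coords (φ Q) → ∀ i,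
      eval (coords Q) (aeval F (G i)) = c ^ e * eval (coords (φ Q)) (G i) := by
    intro Q c hc i
    rw [← eval_smul_of_homogeneous (hG i), ← hc]
    induction G i using MvPolynomial.induction_on with
    | C a => simp
    | add p q hp hq => simp only [map_add, hp, hq]
    | mul_X p n hp => simp only [map_mul, hp, aeval_X, eval_X]
  refine ⟨d * e, fun i => aeval F (G i), fun i => (hG i).aeval F hF, ?_, fun Q => ?_⟩
  · obtain ⟨c, hc⟩ := hFQ P
    obtain ⟨i, hi⟩ := hGP
    exact ⟨i, by rw [key P c hc i]; exact mul_ne_zero (pow_ne_zero _ (ne_zero hFP hc)) hi⟩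
  · obtain ⟨c, hc⟩ := hFQ Q
    obtain ⟨c', hc'⟩ := hGQ (φ Q)
    refine ⟨c ^ e * c', funext fun i => ?_⟩
    rw [key Q c hc i, congrFun hc' i]
    simp [mul_assoc]

end Morphisms

section Addition

variable {K : Type*} [Field K] {E : WeierstrassCurve K}

theorem exists_addXYZ_eq [DecidableEq K] (P Q : E.toAffine.Point) :
    ∃ c : K, E.toProjective.addXYZ (coords P) (coords Q) = c • coords (P + Q) ∧
      (P ≠ Q → c ≠ 0) := by
  have hP := coords_equation P
  have hQ := coords_equation Q
  by_cases hPQ : P = Q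
  · subst hPQ
    refine ⟨0, ?_, fun h => (h rfl).elim⟩
    rw [WeierstrassCurve.Projective.addXYZ_self]
    ext i; fin_cases i <;> simp
  rcases P with _ | ⟨x₁, y₁, h₁⟩
  · rw [WeierstrassCurve.Projective.addXYZ_of_Z_eq_zero_left hP (by simp [coords]),
      ← WeierstrassCurve.Affine.Point.zero_def, zero_add]
    refine ⟨_, rfl, fun _ => ?_⟩
    rcases Q with _ | ⟨x₂, y₂, h₂⟩
    · exact (hPQ rfl).elim
    · simp [coords]
  rcases Q with _ | ⟨x₂, y₂, h₂⟩
  · rw [WeierstrassCurve.Projective.addXYZ_of_Z_eq_zero_right hQ (by simp [coords]),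
      ← WeierstrassCurve.Affine.Point.zero_def, add_zero]
    refine ⟨_, rfl, fun _ => ?_⟩
    simp [coords]
  by_cases hx : x₁ = x₂
  · have hy : y₁ ≠ y₂ := fun hy => hPQ (by subst hx hy; rfl)
    have hy' : y₁ = E.toAffine.negY x₂ y₂ :=
      (WeierstrassCurve.Affine.Y_eq_of_X_eq h₁.1 h₂.1 hx).resolve_left hy
    rw [WeierstrassCurve.Projective.addXYZ_of_X_eq hP hQ (by simp [coords]) (by simp [coords])
      (by simp [coords, hx]), WeierstrassCurve.Affine.Point.add_of_Y_eq hx hy']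
    exact ⟨_, rfl, fun _ => WeierstrassCurve.Projective.addU_ne_zero_of_Y_ne (by simp [coords])
      (by simp [coords]) (by simpa [coords] using hy)⟩
  · have hx' : coords (.some x₁ y₁ h₁ : E.toAffine.Point) 0 *
        coords (.some x₂ y₂ h₂ : E.toAffine.Point) 2 ≠
        coords (.some x₂ y₂ h₂ : E.toAffine.Point) 0 *
        coords (.some x₁ y₁ h₁ : E.toAffine.Point) 2 := by simpa [coords] using hx
    rw [WeierstrassCurve.Projective.addXYZ_of_Z_ne_zero hP hQ (by simp [coords]) (by simp [coords])
      hx', WeierstrassCurve.Affine.Point.add_some (fun h => hx h.1)]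
    refine ⟨_, ?_, fun _ => WeierstrassCurve.Projective.addZ_ne_zero_of_X_ne hP hQ hx'⟩
    simp [coords]

theorem of_eq_degree {f : MvPolynomial (Fin 3) K} {m n : ℕ} (hf : f.IsHomogeneous m) (h : m = n) :
    f.IsHomogeneous n := h ▸ hf

theorem addXYZ_isHomogeneous {F G : Fin 3 → MvPolynomial (Fin 3) K} {d e : ℕ}
    (hF : ∀ i, (F i).IsHomogeneous d) (hG : ∀ i, (G i).IsHomogeneous e) (i : Fin 3) :
    ((E.map C).toProjective.addXYZ F G i).IsHomogeneous (2 * d + 2 * e) := by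
  have hc : ∀ a : K, (C a : MvPolynomial (Fin 3) K).IsHomogeneous 0 := isHomogeneous_C _
  have h2 : (2 : MvPolynomial (Fin 3) K).IsHomogeneous 0 := by
    rw [← map_ofNat (C : K →+* MvPolynomial (Fin 3) K) 2]; exact hc _
  have h3 : (3 : MvPolynomial (Fin 3) K).IsHomogeneous 0 := by
    rw [← map_ofNat (C : K →+* MvPolynomial (Fin 3) K) 3]; exact hc _
  have hadd : ∀ {f g : MvPolynomial (Fin 3) K} {n : ℕ}, f.IsHomogeneous n → g.IsHomogeneous n →
      (f + g).IsHomogeneous n := fun hf hg => hf.add hg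
  have hsub : ∀ {f g : MvPolynomial (Fin 3) K} {n : ℕ}, f.IsHomogeneous n → g.IsHomogeneous n →
      (f - g).IsHomogeneous n := fun hf hg => hf.sub hg
  have hX : ((E.map C).toProjective.addX F G).IsHomogeneous (2 * d + 2 * e) := by
    simp only [WeierstrassCurve.Projective.addX, WeierstrassCurve.map_a₁, WeierstrassCurve.map_a₂,
      WeierstrassCurve.map_a₃, WeierstrassCurve.map_a₄, WeierstrassCurve.map_a₆]
    repeat' first | with_reducible apply hadd | with_reducible apply hsub
    all_goals
      apply of_eq_degree
      · repeat' first
          | with_reducible exact hF _ | with_reducible exact hG _ | with_reducible exact (hF _).neg | with_reducible exact hc _ | with_reducible exact h2 | with_reducible exact h3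
          | with_reducible exact h3.neg | with_reducible apply IsHomogeneous.mul | with_reducible apply IsHomogeneous.pow
      · omega
  have hZ : ((E.map C).toProjective.addZ F G).IsHomogeneous (2 * d + 2 * e) := by
    simp only [WeierstrassCurve.Projective.addZ, WeierstrassCurve.map_a₁, WeierstrassCurve.map_a₂,
      WeierstrassCurve.map_a₃, WeierstrassCurve.map_a₄]
    repeat' first | with_reducible apply hadd | with_reducible apply hsub
    all_goals
      apply of_eq_degree
      · repeat' first
          | with_reducible exact hF _ | with_reducible exact hG _ | with_reducible exact (hF _).neg | with_reducible exact hc _ | with_reducible exact h2 | with_reducible exact h3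
          | with_reducible exact h3.neg | with_reducible apply IsHomogeneous.mul | with_reducible apply IsHomogeneous.pow
      · omega
  have hN : ((E.map C).toProjective.negAddY F G).IsHomogeneous (2 * d + 2 * e) := by
    simp only [WeierstrassCurve.Projective.negAddY, WeierstrassCurve.map_a₁,
      WeierstrassCurve.map_a₂, WeierstrassCurve.map_a₃, WeierstrassCurve.map_a₄,
      WeierstrassCurve.map_a₆]
    repeat' first | with_reducible apply hadd | with_reducible apply hsub
    all_goals
      apply of_eq_degree
      · repeat' first
          | with_reducible exact hF _ | with_reducible exact hG _ | with_reducible exact (hF _).neg | with_reducible exact hc _ | with_reducible exact h2 | with_reducible exact h3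
          | with_reducible exact h3.neg | with_reducible apply IsHomogeneous.mul | with_reducible apply IsHomogeneous.pow
      · omega
  have hY : ((E.map C).toProjective.addY F G).IsHomogeneous (2 * d + 2 * e) := by
    rw [WeierstrassCurve.Projective.addY, WeierstrassCurve.Projective.negY_eq]
    have h1 := (hc E.a₁).mul hX
    have h3 := (hc E.a₃).mul hZ
    rw [zero_add] at h1 h3
    exact (hN.neg.sub h1).sub h3
  fin_cases i
  · exact hX
  · exact hY
  · exact hZ

/-- The sum of two maps is regular at a point where their values differ. -/
theorem IsRegularAt.add_of_ne [DecidableEq K] {E' : WeierstrassCurve K}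
    {φ ψ : E'.toAffine.Point → E.toAffine.Point} {P : E'.toAffine.Point}
    (hφ : IsRegularAt φ P) (hψ : IsRegularAt ψ P) (hne : φ P ≠ ψ P) :
    IsRegularAt (fun Q => φ Q + ψ Q) P := by
  obtain ⟨d, F, hF, hFP, hFQ⟩ := hφ
  obtain ⟨e, G, hG, hGP, hGQ⟩ := hψ
  have key : ∀ (Q : E'.toAffine.Point) (a b : K),
      (fun i => eval (coords Q) (F i)) = a • coords (φ Q) →
      (fun i => eval (coords Q) (G i)) = b • coords (ψ Q) →
      (fun i => eval (coords Q) ((E.map C).toProjective.addXYZ F G i)) =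
        (a * b) ^ 2 • E.toProjective.addXYZ (coords (φ Q)) (coords (ψ Q)) := by
    intro Q a b ha hb
    rw [← WeierstrassCurve.Projective.addXYZ_smul, ← ha, ← hb]
    have := WeierstrassCurve.Projective.map_addXYZ (W' := (E.map C).toProjective)
      (eval (coords Q)) F G
    have hE : (E.map C).map (eval (coords Q)) = E := by
      rw [WeierstrassCurve.map_map]
      convert E.map_id
      ext; simp
    have h2 : ((E.map C).toProjective.map (eval (coords Q))) = E.toProjective := hE
    rw [h2] at this
    exact this.symm
  refine ⟨_, _, addXYZ_isHomogeneous (E := E) hF hG, ?_, fun Q => ?_⟩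
  · obtain ⟨a, ha⟩ := hFQ P
    obtain ⟨b, hb⟩ := hGQ P
    obtain ⟨c, hc, hc'⟩ := exists_addXYZ_eq (φ P) (ψ P)
    obtain ⟨i, hi⟩ := coords_ne_zero (φ P + ψ P)
    refine ⟨i, ?_⟩
    rw [congrFun (key P a b ha hb) i, hc]
    simp only [Pi.smul_apply, smul_eq_mul]
    exact mul_ne_zero (pow_ne_zero _ (mul_ne_zero (ne_zero hFP ha) (ne_zero hGP hb)))
      (mul_ne_zero (hc' hne) hi)
  · obtain ⟨a, ha⟩ := hFQ Q
    obtain ⟨b, hb⟩ := hGQ Q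
    obtain ⟨c, hc, -⟩ := exists_addXYZ_eq (φ Q) (ψ Q)
    exact ⟨(a * b) ^ 2 * c, by rw [key Q a b ha hb, hc, smul_smul]⟩

theorem isRegularAt_neg (P : E.toAffine.Point) : IsRegularAt (fun Q => -Q) P := by
  have key : ∀ Q : E.toAffine.Point, ∃ c : K, c ≠ 0 ∧ (fun i => eval (coords Q)
      ((![X 0, -X 1 - C E.a₁ * X 0 - C E.a₃ * X 2, X 2] : Fin 3 → MvPolynomial (Fin 3) K) i)) =
        c • coords (-Q) := by
    rintro (_ | ⟨x, y, h⟩)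
    · refine ⟨-1, by simp, ?_⟩
      ext i
      rw [← WeierstrassCurve.Affine.Point.zero_def, WeierstrassCurve.Affine.Point.neg_zero]
      fin_cases i <;> simp [coords]
    · refine ⟨1, by simp, ?_⟩
      ext i
      rw [WeierstrassCurve.Affine.Point.neg_some]
      fin_cases i <;> simp [coords, WeierstrassCurve.Affine.negY]
  refine ⟨1, _, fun i => ?_, ?_, fun Q => (key Q).imp fun c hc => hc.2⟩
  · have hX : ∀ (a : K) (j : Fin 3), (C a * X j : MvPolynomial (Fin 3) K).IsHomogeneous 1 :=
      fun a j => by simpa using (isHomogeneous_C (Fin 3) a).mul (isHomogeneous_X K j)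
    fin_cases i
    · exact isHomogeneous_X _ _
    · exact ((isHomogeneous_X _ _).neg.sub (hX _ _)).sub (hX _ _)
    · exact isHomogeneous_X _ _
  · obtain ⟨c, hc, h⟩ := key P
    obtain ⟨i, hi⟩ := coords_ne_zero (-P)
    exact ⟨i, by rw [congrFun h i]; exact mul_ne_zero hc hi⟩

variable [IsAlgClosed K] [E.IsElliptic]

/-- A non-2-torsion point distinct from a given point and its negative. -/
theorem exists_aux_point (A : E.toAffine.Point) :
    ∃ T : E.toAffine.Point, T ≠ -T ∧ T ≠ A ∧ T ≠ -A := by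
  classical
  set f : Polynomial K := E.twoTorsionPolynomial.toPoly with hf
  have hf0 : f ≠ 0 := by
    intro h
    have hC : E.twoTorsionPolynomial = 0 := Cubic.toPoly_eq_zero_iff _ |>.mp h
    have h2 : E.b₂ = 0 := congrArg Cubic.b hC
    have h4 : 2 * E.b₄ = 0 := congrArg Cubic.c hC
    have h6 : E.b₆ = 0 := congrArg Cubic.d hC
    refine (E.coe_Δ' ▸ E.Δ'.ne_zero : E.Δ ≠ 0) ?_
    rw [WeierstrassCurve.Δ, h2, h6]
    linear_combination (-4 * E.b₄ ^ 2) * h4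
  obtain ⟨x, hx⟩ : ∃ x, x ∉ insert (coords A 0) (f.roots.toFinset : Set K) :=
    (Set.Finite.insert _ (Finset.finite_toSet _)).infinite_compl.nonempty
  rw [Set.mem_insert_iff, not_or] at hx
  obtain ⟨hxA, hxf⟩ := hx
  have hxf' : f.eval x ≠ 0 := fun h => hxf (by simpa [hf0] using h)
  obtain ⟨y, hy⟩ : ∃ y, E.toAffine.Equation x y := by
    obtain ⟨y, hy⟩ := IsAlgClosed.exists_root
      (E.toAffine.polynomial.map (Polynomial.evalRingHom x)) (by
        rw [WeierstrassCurve.Affine.monic_polynomial.degree_map,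
          WeierstrassCurve.Affine.degree_polynomial]
        decide)
    refine ⟨y, ?_⟩
    rw [WeierstrassCurve.Affine.Equation, ← Polynomial.map_evalRingHom_eval]
    exact hy
  have hns : E.toAffine.Nonsingular x y := WeierstrassCurve.Affine.equation_iff_nonsingular.mp hy
  refine ⟨.some x y hns, fun h => hxf' ?_, fun h => hxA ?_, fun h => hxA ?_⟩
  · rw [WeierstrassCurve.Affine.Point.neg_some, WeierstrassCurve.Affine.Point.some.injEq,
      WeierstrassCurve.Affine.negY] at h
    rw [WeierstrassCurve.Affine.equation_iff] at hy
    simp only [hf, WeierstrassCurve.twoTorsionPolynomial, Cubic.toPoly, Polynomial.eval_add,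
      Polynomial.eval_mul, Polynomial.eval_pow, Polynomial.eval_C, Polynomial.eval_X,
      WeierstrassCurve.b₂, WeierstrassCurve.b₄, WeierstrassCurve.b₆]
    linear_combination (2 * y + E.a₁ * x + E.a₃) * h.2 - 4 * hy
  · rw [← h]
    simp [coords]
  · rw [← neg_neg A, ← h, WeierstrassCurve.Affine.Point.neg_some]
    simp [coords]

theorem IsRegularAt.add [DecidableEq K] {E' : WeierstrassCurve K}
    {φ ψ : E'.toAffine.Point → E.toAffine.Point} {P : E'.toAffine.Point}
    (hφ : IsRegularAt φ P) (hψ : IsRegularAt ψ P) :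
    IsRegularAt (fun Q => φ Q + ψ Q) P := by
  by_cases hne : φ P = ψ P
  · obtain ⟨T, h1, h2, h3⟩ := exists_aux_point (φ P)
    have ha := hφ.add_of_ne (isRegularAt_const T P) (Ne.symm h2)
    have hb := hψ.add_of_ne (isRegularAt_const (-T) P)
      (fun h => h3 (by rw [hne, h, neg_neg]))
    have hc := ha.add_of_ne hb (fun h => h1 (by rw [hne] at h; exact add_left_cancel h))
    have he : (fun Q => φ Q + T + (ψ Q + -T)) = fun Q => φ Q + ψ Q := funext fun Q => by abel
    rwa [he] at hc
  · exact hφ.add_of_ne hψ hne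

end Addition

section Main

variable {K : Type*} [Field K]

/-- The endomorphism ring of an elliptic curve over an algebraically closed field `K`: the group
endomorphisms of the curve that are morphisms of curves, with pointwise addition and with
composition as multiplication. -/
def endRing [DecidableEq K] [IsAlgClosed K] (E : WeierstrassCurve K) [E.IsElliptic] :
    Subring (AddMonoid.End E.toAffine.Point) where
  carrier := {φ | IsMorphism φ}
  mul_mem' {_ _} hφ hψ P := (hφ _).comp (hψ P)
  one_mem' P := isRegularAt_id P
  add_mem' {_ _} hφ hψ P := (hφ P).add (hψ P)
  zero_mem' P := isRegularAt_const 0 P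
  neg_mem' {_} hφ P := (isRegularAt_neg _).comp (hφ P)

/-- A curve over a field of characteristic `p` is supersingular if it has no point of order `p`
(to be used over an algebraically closed field). -/
def IsSupersingular [DecidableEq K] (p : ℕ) (E : WeierstrassCurve K) : Prop :=
  ∀ P : E.toAffine.Point, p • P = 0 → P = 0

/-- `E` is defined over the subfield `k` if it is isomorphic over `K` to an elliptic curve given by a
Weierstrass equation with coefficients in `k`. -/
def IsDefinedOver (k : Type*) [Field k] [Algebra k K] (E : WeierstrassCurve K) : Prop :=
  ∃ (E₀ : WeierstrassCurve k) (u : WeierstrassCurve.VariableChange K),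
    E₀.IsElliptic ∧ u • E₀.baseChange K = E

end Main

end EllCurve

namespace EllCurve

open WeierstrassCurve

/-! ### Changes of variables as isomorphisms of groups, curves and endomorphism rings. -/

section VariableChange

open MvPolynomial

variable {K : Type*} [Field K] {E E' : WeierstrassCurve K}

/-! Everything rests on a degree function on `endRing E` read off from x-coordinates alone. On a
short Weierstrass curve an endomorphism commutes with negation, so it induces a self-map f/g of the
projective line (`exists_isXRep`), and `deg` is the degree of that map. The formulas relating x(P +
Q) and x(P - Q) to x(P) and x(Q) give the parallelogram law (`deg_add_add_deg_sub`), composition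
gives multiplicativity (`deg_mul`), and only zero has degree zero. These facts, with `deg 1 = 1`,
force every endomorphism to satisfy its integral quadratic characteristic equation
(`mul_self_sub_trace_add_norm`), without dual isogenies.

Supersingularity enters through injectivity of [p]. An injective endomorphism has no pole at an
affine point and is injective on x-coordinates, hence acts on them as cxⁿ + d. If n is a power q of
p, looking at 2-torsion forces d = 0, a₄ = c²a₄^q and a₆ = c³a₆^q (`exists_xCoord_eq_mul_pow`).

If the curve is defined over the prime field, apply this to [p], of degree p². The result is [p] =
ρπ² with π the Frobenius and ρ an automorphism. Substituting into π² - aπ + p = 0 and cancelling π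
gives (1 + ρ)π = a. Degrees give p·deg(1 + ρ) = a², so p divides deg(1 + ρ) ≤ 4; as p ≥ 5, ρ = -1
and π² = -p (`frob_mul_self`).

Conversely, an α with α² = -p has degree p and is injective because [p] is. The relations with q = p
give j^p = j, so j lies in the prime field, and over an algebraically closed field j determines the
curve up to isomorphism (`isDefinedOver_of_mul_self_eq_neg`). -/

theorem variableChange_equation {C : VariableChange K} (h : C • E = E') {x y : K}
    (hxy : E'.toAffine.Equation x y) :
    E.toAffine.Equation (C.u ^ 2 * x + C.r) (C.u ^ 3 * y + C.u ^ 2 * C.s * x + C.t) := by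
  subst h
  rw [Affine.equation_iff] at hxy ⊢
  simp only [variableChange_a₁, variableChange_a₂, variableChange_a₃, variableChange_a₄,
    variableChange_a₆, Units.val_inv_eq_inv_val] at hxy
  have hu : (C.u : K) ≠ 0 := C.u.ne_zero
  field_simp at hxy
  linear_combination hxy

theorem variableChange_negY {C : VariableChange K} (h : C • E = E') (x y : K) :
    E.toAffine.negY (C.u ^ 2 * x + C.r) (C.u ^ 3 * y + C.u ^ 2 * C.s * x + C.t) =
      C.u ^ 3 * E'.toAffine.negY x y + C.u ^ 2 * C.s * x + C.t := by
  subst h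
  have hu : (C.u : K) ≠ 0 := C.u.ne_zero
  simp only [Affine.negY, variableChange_a₁, variableChange_a₃, Units.val_inv_eq_inv_val]
  field_simp
  ring

/-- The substitution carries lines to lines, turning slope ℓ into uℓ + s, which is what makes it
compatible with the chord-tangent law. Keeping `E'` separate from `C • E` allows `E' = E` later,
when the substitution is an automorphism. -/
theorem variableChange_slope [DecidableEq K] {C : VariableChange K} (h : C • E = E')
    {x₁ x₂ y₁ y₂ : K} (hxy : ¬(x₁ = x₂ ∧ y₁ = E'.toAffine.negY x₂ y₂))
    (h₁ : E'.toAffine.Equation x₁ y₁) (h₂ : E'.toAffine.Equation x₂ y₂) :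
    E.toAffine.slope (C.u ^ 2 * x₁ + C.r) (C.u ^ 2 * x₂ + C.r)
      (C.u ^ 3 * y₁ + C.u ^ 2 * C.s * x₁ + C.t) (C.u ^ 3 * y₂ + C.u ^ 2 * C.s * x₂ + C.t) =
      C.u * E'.toAffine.slope x₁ x₂ y₁ y₂ + C.s := by
  have hu : (C.u : K) ≠ 0 := C.u.ne_zero
  by_cases hx : x₁ = x₂
  · subst hx
    have hy : y₁ ≠ E'.toAffine.negY x₁ y₂ := fun hy => hxy ⟨rfl, hy⟩
    have hyy : y₁ = y₂ := Affine.Y_eq_of_Y_ne h₁ h₂ rfl hy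
    subst hyy
    have hy' : C.u ^ 3 * y₁ + C.u ^ 2 * C.s * x₁ + C.t ≠
        E.toAffine.negY (C.u ^ 2 * x₁ + C.r) (C.u ^ 3 * y₁ + C.u ^ 2 * C.s * x₁ + C.t) := by
      rw [variableChange_negY h]
      simpa [hu] using hy
    rw [Affine.slope_of_Y_ne rfl hy, Affine.slope_of_Y_ne rfl hy', variableChange_negY h]
    have h1 : y₁ - E'.toAffine.negY x₁ y₁ ≠ 0 := sub_ne_zero.mpr hy
    have h2 : (C.u ^ 3 * y₁ + C.u ^ 2 * C.s * x₁ + C.t) -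
      (C.u ^ 3 * E'.toAffine.negY x₁ y₁ + C.u ^ 2 * C.s * x₁ + C.t) =
        C.u ^ 3 * (y₁ - E'.toAffine.negY x₁ y₁) := by ring
    rw [h2, div_eq_iff (mul_ne_zero (pow_ne_zero _ hu) h1), add_mul]
    have h3 : C.u * ((3 * x₁ ^ 2 + 2 * E'.toAffine.a₂ * x₁ + E'.toAffine.a₄ -
        E'.toAffine.a₁ * y₁) / (y₁ - E'.toAffine.negY x₁ y₁)) *
        (C.u ^ 3 * (y₁ - E'.toAffine.negY x₁ y₁)) = C.u ^ 4 * (3 * x₁ ^ 2 +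
        2 * E'.toAffine.a₂ * x₁ + E'.toAffine.a₄ - E'.toAffine.a₁ * y₁) := by
      field_simp
    rw [h3]
    subst h
    simp only [Affine.negY, variableChange_a₁, variableChange_a₂, variableChange_a₃,
      variableChange_a₄, Units.val_inv_eq_inv_val]
    field_simp
    ring
  · have hx' : C.u ^ 2 * x₁ + C.r ≠ C.u ^ 2 * x₂ + C.r := by simpa [hu] using hx
    rw [Affine.slope_of_X_ne hx, Affine.slope_of_X_ne hx']
    have h1 : x₁ - x₂ ≠ 0 := sub_ne_zero.mpr hx
    have h2 : C.u ^ 2 * x₁ + C.r - (C.u ^ 2 * x₂ + C.r) = C.u ^ 2 * (x₁ - x₂) := by ring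
    rw [h2]
    field_simp
    ring

variable [E.IsElliptic]

/-- The substitution `(x, y) ↦ (u²x + r, u³y + u²sx + t)`, as a map from the points of `C • E` to the
points of `E`. -/
def variableChangeFun {C : VariableChange K} (h : C • E = E') : E'.toAffine.Point → E.toAffine.Point
  | .zero => 0
  | .some _ _ hxy => .some _ _
      (Affine.equation_iff_nonsingular.mp (variableChange_equation h hxy.1))

/-- The substitution `(x, y) ↦ (u²x + r, u³y + u²sx + t)`, as a group homomorphism from the points of
`C • E` to the points of `E`. -/
def variableChangeHom [DecidableEq K] {C : VariableChange K} (h : C • E = E') :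
    E'.toAffine.Point →+ E.toAffine.Point where
  toFun := variableChangeFun h
  map_zero' := rfl
  map_add' := by
    have hu : (C.u : K) ≠ 0 := C.u.ne_zero
    rintro (_ | ⟨x₁, y₁, h₁⟩) (_ | ⟨x₂, y₂, h₂⟩)
    any_goals rfl
    by_cases hxy : x₁ = x₂ ∧ y₁ = E'.toAffine.negY x₂ y₂
    · rw [Affine.Point.add_of_Y_eq hxy.1 hxy.2]
      refine (Affine.Point.add_of_Y_eq (by rw [hxy.1]) ?_).symm
      rw [variableChange_negY h, hxy.1, hxy.2]
    · rw [Affine.Point.add_some hxy]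
      have hxy' : ¬(C.u ^ 2 * x₁ + C.r = C.u ^ 2 * x₂ + C.r ∧
          C.u ^ 3 * y₁ + C.u ^ 2 * C.s * x₁ + C.t =
          E.toAffine.negY (C.u ^ 2 * x₂ + C.r) (C.u ^ 3 * y₂ + C.u ^ 2 * C.s * x₂ + C.t)) := by
        rw [variableChange_negY h]
        rintro ⟨ha, hb⟩
        have ha' : x₁ = x₂ := by simpa [hu] using ha
        subst ha'
        exact hxy ⟨rfl, by simpa [hu] using hb⟩
      refine Eq.trans ?_ (Affine.Point.add_some hxy').symm
      simp only [variableChangeFun, Affine.Point.some.injEq, variableChange_slope h hxy h₁.1 h₂.1]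
      set ℓ := E'.toAffine.slope x₁ x₂ y₁ y₂
      have hX : C.u ^ 2 * E'.toAffine.addX x₁ x₂ ℓ + C.r =
          E.toAffine.addX (C.u ^ 2 * x₁ + C.r) (C.u ^ 2 * x₂ + C.r) (C.u * ℓ + C.s) := by
        subst h
        simp only [Affine.addX, variableChange_a₁, variableChange_a₂, Units.val_inv_eq_inv_val]
        field_simp
        ring
      refine ⟨hX, ?_⟩
      rw [Affine.addY, Affine.addY, ← hX, Affine.negAddY, Affine.negAddY, ← hX,
        ← variableChange_negY h]
      congr 1
      ring

theorem variableChangeHom_zero [DecidableEq K] {C : VariableChange K} (h : C • E = E') :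
    variableChangeHom h .zero = 0 := rfl

theorem variableChangeHom_some [DecidableEq K] {C : VariableChange K} (h : C • E = E') {x y : K}
    (hxy : E'.toAffine.Nonsingular x y) :
    variableChangeHom h (.some x y hxy) = .some (C.u ^ 2 * x + C.r)
      (C.u ^ 3 * y + C.u ^ 2 * C.s * x + C.t)
      (Affine.equation_iff_nonsingular.mp (variableChange_equation h hxy.1)) := rfl

theorem isMorphism_variableChangeHom [DecidableEq K] {C : VariableChange K} (h : C • E = E') :
    IsMorphism (variableChangeHom h) := by
  intro P
  have key : ∀ Q : E'.toAffine.Point, ∃ c : K, c ≠ 0 ∧ (fun i => eval (coords Q)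
      ((![MvPolynomial.C (C.u ^ 2 : K) * X 0 + MvPolynomial.C C.r * X 2,
        MvPolynomial.C (C.u ^ 3 : K) * X 1 + MvPolynomial.C (C.u ^ 2 * C.s) * X 0 +
          MvPolynomial.C C.t * X 2,
        X 2] : Fin 3 → MvPolynomial (Fin 3) K) i)) = c • coords (variableChangeHom h Q) := by
    rintro (_ | ⟨x, y, hxy⟩)
    -- The linear forms send (0, 1, 0) to (0, u³, 0).
    · refine ⟨C.u ^ 3, pow_ne_zero _ C.u.ne_zero, ?_⟩
      rw [variableChangeHom_zero, Affine.Point.zero_def]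
      ext i
      fin_cases i <;> simp [coords]
    · refine ⟨1, one_ne_zero, ?_⟩
      rw [variableChangeHom_some]
      ext i
      fin_cases i <;> simp [coords]
  refine ⟨1, _, fun i => ?_, ?_, fun Q => (key Q).imp fun c hc => hc.2⟩
  · have hX : ∀ (a : K) (j : Fin 3), (MvPolynomial.C a * X j : MvPolynomial (Fin 3) K).IsHomogeneous
        1 := isHomogeneous_C_mul_X
    fin_cases i
    · exact (hX _ _).add (hX _ _)
    · exact ((hX _ _).add (hX _ _)).add (hX _ _)
    · exact isHomogeneous_X _ _
  · obtain ⟨c, hc, h'⟩ := key P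
    obtain ⟨i, hi⟩ := coords_ne_zero (variableChangeHom h P)
    exact ⟨i, by rw [congrFun h' i]; exact mul_ne_zero hc hi⟩

theorem variableChangeHom_variableChangeHom [DecidableEq K] [E'.IsElliptic]
    {C D : VariableChange K} (hD : D = C⁻¹) (h : C • E = E') (h' : D • E' = E) (P : E.toAffine.Point) :
    variableChangeHom h (variableChangeHom h' P) = P := by
  subst hD
  have hu : (C.u : K) ≠ 0 := C.u.ne_zero
  rcases P with _ | ⟨x, y, hxy⟩
  · rfl
  · simp only [variableChangeHom_some, Affine.Point.some.injEq, VariableChange.inv_def,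
      Units.val_inv_eq_inv_val]
    constructor <;> (field_simp; try ring)

/-- The group isomorphism of the points of `C • E` with the points of `E`. -/
def variableChangeEquiv [DecidableEq K] [E'.IsElliptic] {C : VariableChange K} (h : C • E = E') :
    E'.toAffine.Point ≃+ E.toAffine.Point :=
  { variableChangeHom h with
    invFun := variableChangeHom (inv_smul_eq_iff.mpr h.symm : C⁻¹ • E' = E)
    left_inv := fun P => variableChangeHom_variableChangeHom (inv_inv C).symm
      (inv_smul_eq_iff.mpr h.symm) h P
    right_inv := fun P => variableChangeHom_variableChangeHom rfl h _ P }

theorem IsSupersingular.of_variableChange [DecidableEq K] [E'.IsElliptic] {p : ℕ}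
    {C : VariableChange K} (h : C • E = E') (hE : IsSupersingular p E) : IsSupersingular p E' := by
  intro P hP
  have h1 := hE (variableChangeEquiv h P) (by rw [← map_nsmul, hP, map_zero])
  simpa using h1

/-- Isomorphic elliptic curves have isomorphic endomorphism rings. -/
def endRingVariableChange [DecidableEq K] [IsAlgClosed K] [E'.IsElliptic] {C : VariableChange K}
    (h : C • E = E') : endRing E →+* endRing E' where
  toFun φ := ⟨((variableChangeEquiv h).symm.toAddMonoidHom.comp φ.1).comp
      (variableChangeEquiv h).toAddMonoidHom, fun P =>
    ((isMorphism_variableChangeHom (inv_smul_eq_iff.mpr h.symm : C⁻¹ • E' = E) _).comp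
      (φ.2 _)).comp (isMorphism_variableChangeHom h P)⟩
  map_one' := by
    ext P
    exact (variableChangeEquiv h).symm_apply_apply P
  map_zero' := by
    ext P
    exact map_zero (variableChangeEquiv h).symm
  map_add' φ ψ := by
    ext P
    exact map_add (variableChangeEquiv h).symm _ _
  map_mul' φ ψ := by
    ext P
    change (variableChangeEquiv h).symm (φ.1 (ψ.1 (variableChangeEquiv h P))) =
      (variableChangeEquiv h).symm (φ.1 (variableChangeEquiv h
        ((variableChangeEquiv h).symm (ψ.1 (variableChangeEquiv h P)))))
    rw [AddEquiv.apply_symm_apply]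

theorem endRingVariableChange_injective [DecidableEq K] [IsAlgClosed K] [E'.IsElliptic]
    {C : VariableChange K} (h : C • E = E') : Function.Injective (endRingVariableChange h) := by
  intro φ ψ hφψ
  ext P
  have h1 := DFunLike.congr_fun (congrArg Subtype.val hφψ) ((variableChangeEquiv h).symm P)
  change (variableChangeEquiv h).symm (φ.1 (variableChangeEquiv h ((variableChangeEquiv h).symm P)))
    = (variableChangeEquiv h).symm (ψ.1 (variableChangeEquiv h ((variableChangeEquiv h).symm P)))
    at h1
  simpa using h1

end VariableChange

/-! ### The rational function an endomorphism induces on x-coordinates. -/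

section XRep

variable {K : Type*} [Field K] (E : WeierstrassCurve K)

/-- The right-hand side `X³ + a₄X + a₆` of a short Weierstrass equation. -/
noncomputable def cubic : Polynomial K :=
  Polynomial.X ^ 3 + Polynomial.C E.a₄ * Polynomial.X + Polynomial.C E.a₆

theorem eval_cubic (x : K) : (cubic E).eval x = x ^ 3 + E.a₄ * x + E.a₆ := by
  simp [cubic]

theorem cubic_natDegree : (cubic E).natDegree = 3 := by
  unfold cubic
  compute_degree!

theorem cubic_ne_zero : cubic E ≠ 0 := fun h => by
  have := cubic_natDegree E
  simp [h] at this

variable {E}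

theorem equation_iff_of_isShortNF [E.IsShortNF] {x y : K} :
    E.toAffine.Equation x y ↔ y ^ 2 = (cubic E).eval x := by
  rw [Affine.equation_iff, eval_cubic, E.a₁_of_isShortNF, E.a₂_of_isShortNF, E.a₃_of_isShortNF]
  simp

theorem negY_of_isShortNF [E.IsShortNF] (x y : K) : E.toAffine.negY x y = -y := by
  simp [Affine.negY]

theorem discr_ne_zero (E : WeierstrassCurve K) [E.IsShortNF] [E.IsElliptic] :
    -16 * (4 * E.a₄ ^ 3 + 27 * E.a₆ ^ 2) ≠ 0 := by
  rw [← E.Δ_of_isShortNF, ← E.coe_Δ']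
  exact E.Δ'.ne_zero

theorem two_ne_zero_of_isElliptic (E : WeierstrassCurve K) [E.IsShortNF] [E.IsElliptic] :
    (2 : K) ≠ 0 := fun h => discr_ne_zero E (by
  linear_combination (-8 * (4 * E.a₄ ^ 3 + 27 * E.a₆ ^ 2)) * h)

theorem exists_equation [IsAlgClosed K] [E.IsShortNF] (x : K) : ∃ y, E.toAffine.Equation x y := by
  obtain ⟨y, hy⟩ := IsAlgClosed.exists_pow_nat_eq ((cubic E).eval x) two_pos
  exact ⟨y, equation_iff_of_isShortNF.mpr hy⟩

/-- On a short Weierstrass curve every polynomial function has the form `a(x) + b(x)y`. -/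
theorem exists_normalForm [E.IsShortNF] (G : MvPolynomial (Fin 3) K) :
    ∃ a b : Polynomial K, ∀ x y, E.toAffine.Equation x y →
      MvPolynomial.eval ![x, y, 1] G = a.eval x + b.eval x * y := by
  induction G using MvPolynomial.induction_on with
  | C c => exact ⟨Polynomial.C c, 0, fun x y _ => by simp⟩
  | add G H hG hH =>
    obtain ⟨a, b, h⟩ := hG
    obtain ⟨a', b', h'⟩ := hH
    exact ⟨a + a', b + b', fun x y hxy => by simp [h x y hxy, h' x y hxy]; ring⟩
  | mul_X G i hG =>
    obtain ⟨a, b, h⟩ := hG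
    fin_cases i
    · exact ⟨a * Polynomial.X, b * Polynomial.X, fun x y hxy => by simp [h x y hxy]; ring⟩
    · refine ⟨b * cubic E, a, fun x y hxy => ?_⟩
      simp [h x y hxy, ← equation_iff_of_isShortNF.mp hxy]; ring
    · exact ⟨a, b, fun x y hxy => by simp [h x y hxy]⟩

/-- Parity of degrees: the left side has even degree, the right side odd degree. So the norm a² -
b²(x³ + a₄x + a₆) of a function a + by vanishes only when a = b = 0. -/
theorem eq_zero_of_sq_eq_sq_mul_cubic {a b : Polynomial K} (h : a ^ 2 = b ^ 2 * cubic E) :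
    a = 0 ∧ b = 0 := by
  by_cases hb : b = 0
  · subst hb
    exact ⟨by simpa using h, rfl⟩
  · have h1 := congrArg Polynomial.natDegree h
    rw [Polynomial.natDegree_pow, Polynomial.natDegree_mul (pow_ne_zero _ hb) (cubic_ne_zero E),
      Polynomial.natDegree_pow, cubic_natDegree] at h1
    omega

theorem eq_zero_of_forall_eval_eq_zero {R : Type*} [CommRing R] [IsDomain R] [Infinite R]
    {f : Polynomial R} (h : ∀ x, f.eval x = 0) : f = 0 :=
  Polynomial.funext fun x => by simp [h x]

variable (E) in
/-- The polynomial function `G` vanishes on the affine part of the curve. -/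
def Vanishes (G : MvPolynomial (Fin 3) K) : Prop :=
  ∀ x y, E.toAffine.Equation x y → MvPolynomial.eval ![x, y, 1] G = 0

/-- The ring of polynomial functions on the curve is a domain. -/
theorem vanishes_or_vanishes [IsAlgClosed K] [E.IsShortNF] {G H : MvPolynomial (Fin 3) K}
    (h : Vanishes E (G * H)) : Vanishes E G ∨ Vanishes E H := by
  obtain ⟨a, b, hG⟩ := exists_normalForm (E := E) G
  obtain ⟨c, d, hH⟩ := exists_normalForm (E := E) H
  -- The norm to polynomials in x is multiplicative, so the question moves to a polynomial ring,
  -- which is a domain.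
  have key : (a ^ 2 - b ^ 2 * cubic E) * (c ^ 2 - d ^ 2 * cubic E) = 0 := by
    refine eq_zero_of_forall_eval_eq_zero fun x => ?_
    obtain ⟨y, hy⟩ := exists_equation (E := E) x
    have h1 := h x y hy
    rw [map_mul, hG x y hy, hH x y hy] at h1
    simp only [Polynomial.eval_mul, Polynomial.eval_sub, Polynomial.eval_pow,
      ← equation_iff_of_isShortNF.mp hy]
    linear_combination ((a.eval x - b.eval x * y) * (c.eval x - d.eval x * y)) * h1
  rcases mul_eq_zero.mp key with h0 | h0
  · left
    obtain ⟨rfl, rfl⟩ := eq_zero_of_sq_eq_sq_mul_cubic (sub_eq_zero.mp h0)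
    intro x y hxy
    simp [hG x y hxy]
  · right
    obtain ⟨rfl, rfl⟩ := eq_zero_of_sq_eq_sq_mul_cubic (sub_eq_zero.mp h0)
    intro x y hxy
    simp [hH x y hxy]

theorem coords_zero {E : WeierstrassCurve K} : coords (0 : E.toAffine.Point) = ![0, 1, 0] := rfl

theorem coords_some {E : WeierstrassCurve K} {x y : K} (h : E.toAffine.Nonsingular x y) :
    coords (.some x y h) = ![x, y, 1] := rfl

theorem coords_mul_xRep {E : WeierstrassCurve K} (P : E.toAffine.Point) :
    coords P 0 * P.xRep 1 = coords P 2 * P.xRep 0 := by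
  rcases P with _ | ⟨x, y, h⟩ <;> simp [coords]

theorem eval_aeval_X {x y : K} (f : Polynomial K) :
    MvPolynomial.eval ![x, y, 1] (Polynomial.aeval (MvPolynomial.X 0 : MvPolynomial (Fin 3) K) f) =
      f.eval x := by
  induction f using Polynomial.induction_on' with
  | add p q hp hq => simp [hp, hq]
  | monomial n a => simp [Polynomial.aeval_monomial, MvPolynomial.algebraMap_eq]

theorem exists_affine_point [IsAlgClosed K] [E.IsShortNF] [E.IsElliptic] (x : K) :
    ∃ y, E.toAffine.Nonsingular x y :=
  (exists_equation x).imp fun _ => Affine.equation_iff_nonsingular.mp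

theorem finite_preimage_xRep {E : WeierstrassCurve K} {s : Set (Fin 2 → K)} (hs : s.Finite) :
    (Affine.Point.xRep ⁻¹' s : Set E.toAffine.Point).Finite := by
  refine hs.preimage' fun v _ => ?_
  by_cases h : ∃ P : E.toAffine.Point, P.xRep = v
  · obtain ⟨P, rfl⟩ := h
    refine Set.Finite.subset (Set.toFinite {P, -P}) fun Q hQ => ?_
    exact Affine.Point.eq_or_eq_neg_of_xRep_eq_xRep hQ
  · refine Set.Finite.subset Set.finite_empty fun Q hQ => h ⟨Q, hQ⟩

variable [IsAlgClosed K] [DecidableEq K] [E.IsShortNF] [E.IsElliptic]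

/-- An endomorphism that vanishes at all points outside a finite set is zero. -/
theorem eq_zero_of_eval_ne_zero {φ : AddMonoid.End E.toAffine.Point} {N : Polynomial K} (hN : N ≠ 0)
    (hφ : ∀ x y (h : E.toAffine.Nonsingular x y), N.eval x ≠ 0 → φ (.some x y h) = 0) : φ = 0 := by
  choose y hy using exists_affine_point (E := E)
  by_contra hne
  obtain ⟨P, hP⟩ : ∃ P, φ P ≠ 0 := by
    by_contra! h
    exact hne (AddMonoidHom.ext h)
  have hfin : {x | N.eval x = 0}.Finite := by
    refine Set.Finite.subset (N.roots.toFinset.finite_toSet) fun x hx => ?_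
    simpa [hN] using hx
  have hS : {Q | φ Q ≠ 0}.Finite := by
    refine (finite_preimage_xRep (hfin.image fun x => ![x, 1])).subset fun Q hQ => ?_
    rcases Q with _ | ⟨x, y, h⟩
    · exact (hQ (map_zero φ)).elim
    · exact ⟨x, by_contra fun hx => hQ (hφ x y h hx), rfl⟩
  -- Adding P to a point of the kernel gives a point outside the kernel. Doing so for infinitely
  -- many x contradicts the finiteness of `hS`.
  have hinj : Function.Injective fun x => P + .some x (y x) (hy x) := by
    intro x x' h
    simpa using (Affine.Point.some.inj (add_left_cancel h)).1
  refine hfin.infinite_compl ((hS.preimage hinj.injOn).subset fun x hx => ?_)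
  change φ (P + _) ≠ 0
  rwa [map_add, hφ x _ (hy x) hx, add_zero]

/-- If `φ` is not zero, then the third coordinate of a local presentation of `φ` does not vanish
identically. -/
theorem not_vanishes_of_ne_zero {φ : AddMonoid.End E.toAffine.Point} (hφ : φ ≠ 0)
    {F : Fin 3 → MvPolynomial (Fin 3) K} {i : Fin 3} (hF : ¬ Vanishes E (F i))
    (hQ : ∀ Q, ∃ c : K, (fun i => MvPolynomial.eval (coords Q) (F i)) = c • coords (φ Q)) :
    ¬ Vanishes E (F 2) := by
  intro h2
  -- Where the value of φ is affine, a vanishing third coordinate forces the scalar c to vanish, and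
  -- with it every coordinate of F.
  have hz : ∀ x y (h : E.toAffine.Nonsingular x y), φ (.some x y h) = 0 ∨
      MvPolynomial.eval ![x, y, 1] (F i) = 0 := by
    intro x y h
    by_cases h0 : φ (.some x y h) = 0
    · exact .inl h0
    right
    obtain ⟨c, hc⟩ := hQ (.some x y h)
    rw [coords_some] at hc
    rcases hP : φ (.some x y h) with _ | ⟨x', y', h'⟩
    · exact (h0 hP).elim
    · rw [hP, coords_some] at hc
      have hc2 := congrFun hc 2
      simp only [h2 x y h.1, Pi.smul_apply, smul_eq_mul] at hc2
      have : c = 0 := by simpa using hc2.symm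
      rw [this, zero_smul] at hc
      exact congrFun hc i
  obtain ⟨a, b, hab⟩ := exists_normalForm (E := E) (F i)
  set N := a ^ 2 - b ^ 2 * cubic E with hN
  have hN0 : N ≠ 0 := by
    intro h0
    obtain ⟨rfl, rfl⟩ := eq_zero_of_sq_eq_sq_mul_cubic (sub_eq_zero.mp h0)
    exact hF fun x y hxy => by simp [hab x y hxy]
  refine hφ (eq_zero_of_eval_ne_zero hN0 fun x y h hx => ?_)
  refine (hz x y h).resolve_right fun h0 => hx ?_
  rw [hab x y h.1] at h0
  simp only [hN, Polynomial.eval_sub, Polynomial.eval_mul, Polynomial.eval_pow,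
    ← equation_iff_of_isShortNF.mp h.1]
  linear_combination (a.eval x - b.eval x * y) * h0

/-- The polynomials `f, g` present the map induced by `φ` on `x`-coordinates as the fraction
`f / g`. -/
def IsXRep (φ : AddMonoid.End E.toAffine.Point) (f g : Polynomial K) : Prop :=
  ∀ x y (h : E.toAffine.Nonsingular x y),
    f.eval x * (φ (.some x y h)).xRep 1 = g.eval x * (φ (.some x y h)).xRep 0

/-- A not necessarily reduced fraction presenting a nonzero endomorphism on `x`-coordinates. -/
theorem exists_isXRep_aux {φ : AddMonoid.End E.toAffine.Point} (hφ : φ ≠ 0) (hm : IsMorphism φ) :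
    ∃ u w : Polynomial K, w ≠ 0 ∧ IsXRep φ u w := by
  obtain ⟨y₀, h₀⟩ := exists_affine_point (E := E) 0
  obtain ⟨d, F, -, ⟨i, hi⟩, hQ⟩ := hm (.some 0 y₀ h₀)
  have hF2 := not_vanishes_of_ne_zero hφ (fun h => hi (h 0 y₀ h₀.1)) hQ
  obtain ⟨a, b, h0⟩ := exists_normalForm (E := E) (F 0)
  obtain ⟨a', b', h2⟩ := exists_normalForm (E := E) (F 2)
  -- The denominator is the norm of F₂, the numerator half the trace of F₀ times the conjugate of
  -- F₂. Averaging over (x, y) and (x, -y) is legitimate because φ(P) and φ(-P) have the same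
  -- x-coordinate.
  refine ⟨a * a' - b * b' * cubic E, a' ^ 2 - b' ^ 2 * cubic E, fun h => ?_, fun x y h => ?_⟩
  · obtain ⟨rfl, rfl⟩ := eq_zero_of_sq_eq_sq_mul_cubic (sub_eq_zero.mp h)
    exact hF2 fun x y hxy => by simp [h2 x y hxy]
  · have key : ∀ z (hz : E.toAffine.Nonsingular x z),
        (a.eval x + b.eval x * z) * (φ (.some x z hz)).xRep 1 =
          (a'.eval x + b'.eval x * z) * (φ (.some x z hz)).xRep 0 := by
      intro z hz
      obtain ⟨c, hc⟩ := hQ (.some x z hz)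
      rw [← h0 x z hz.1, ← h2 x z hz.1]
      have e0 := congrFun hc 0
      have e2 := congrFun hc 2
      simp only [coords_some, Pi.smul_apply, smul_eq_mul] at e0 e2
      rw [e0, e2]
      linear_combination c * coords_mul_xRep (φ (.some x z hz))
    have hneg : E.toAffine.Nonsingular x (-y) := by
      have := (Affine.nonsingular_neg x y).mpr h
      rwa [negY_of_isShortNF] at this
    have hP : (.some x (-y) hneg : E.toAffine.Point) = -.some x y h := by
      simp [Affine.Point.neg_some]
    have k1 := key y h
    have k2 := key (-y) hneg
    rw [hP, map_neg, Affine.Point.xRep_neg] at k2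
    refine mul_left_cancel₀ (two_ne_zero_of_isElliptic E) ?_
    simp only [Polynomial.eval_sub, Polynomial.eval_mul, Polynomial.eval_pow,
      ← equation_iff_of_isShortNF.mp h.1]
    linear_combination (a'.eval x - b'.eval x * y) * k1 + (a'.eval x + b'.eval x * y) * k2

/-- Dividing by the gcd d preserves the presentation only where d does not vanish. At the remaining
points it is recovered from a presentation F that is regular there: the identities linking F to f
and g hold off the zeros of d, and extend because functions on the curve form a domain. -/
theorem exists_isXRep {φ : AddMonoid.End E.toAffine.Point} (hm : IsMorphism φ) :
    ∃ f g : Polynomial K, IsCoprime f g ∧ IsXRep φ f g := by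
  by_cases hφ : φ = 0
  · subst hφ
    exact ⟨1, 0, isCoprime_one_left, fun x y h => by simp⟩
  obtain ⟨u, w, hw, huw⟩ := exists_isXRep_aux hφ hm
  obtain ⟨f, hf⟩ := EuclideanDomain.gcd_dvd_left u w
  obtain ⟨g, hg⟩ := EuclideanDomain.gcd_dvd_right u w
  set d := EuclideanDomain.gcd u w with hd
  have hd0 : d ≠ 0 := by
    rintro h0
    rw [h0, zero_mul] at hg
    exact hw hg
  have hcop : IsCoprime f g := by
    refine ⟨EuclideanDomain.gcdA u w, EuclideanDomain.gcdB u w, mul_left_cancel₀ hd0 ?_⟩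
    have := EuclideanDomain.gcd_eq_gcd_ab u w
    rw [← hd] at this
    linear_combination -this - EuclideanDomain.gcdA u w * hf - EuclideanDomain.gcdB u w * hg
  refine ⟨f, g, hcop, fun x₀ y₀ h₀ => ?_⟩
  have hfg : ∀ x y (h : E.toAffine.Nonsingular x y), d.eval x ≠ 0 →
      f.eval x * (φ (.some x y h)).xRep 1 = g.eval x * (φ (.some x y h)).xRep 0 := by
    intro x y h hdx
    have := huw x y h
    rw [hf, hg, Polynomial.eval_mul, Polynomial.eval_mul] at this
    exact mul_left_cancel₀ hdx (by linear_combination this)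
  obtain ⟨n, F, -, ⟨i, hi⟩, hQ⟩ := hm (.some x₀ y₀ h₀)
  have hF2 := not_vanishes_of_ne_zero hφ (fun h => hi (h x₀ y₀ h₀.1)) hQ
  let poly (q : Polynomial K) : MvPolynomial (Fin 3) K := Polynomial.aeval (MvPolynomial.X 0) q
  have hpoly : ∀ q x y, MvPolynomial.eval ![x, y, 1] (poly q) = q.eval x :=
    fun q x y => eval_aeval_X q
  have hnd : ¬ Vanishes E (poly d) := by
    intro h
    refine hd0 (eq_zero_of_forall_eval_eq_zero fun x => ?_)
    obtain ⟨y, hy⟩ := exists_equation (E := E) x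
    rw [← hpoly d x y, h x y hy]
  have hcross : Vanishes E (F 0 * poly g - poly f * F 2) := by
    refine (vanishes_or_vanishes (G := poly d) fun x y hxy => ?_).resolve_left hnd
    by_cases hdx : d.eval x = 0
    · simp [hpoly, hdx]
    have h : E.toAffine.Nonsingular x y := Affine.equation_iff_nonsingular.mp hxy
    obtain ⟨c, hc⟩ := hQ (.some x y h)
    have e0 := congrFun hc 0
    have e2 := congrFun hc 2
    simp only [coords_some, Pi.smul_apply, smul_eq_mul] at e0 e2
    have e := hfg x y h hdx
    simp only [map_mul, map_sub, hpoly, e0, e2]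
    generalize φ (.some x y h) = R at e ⊢
    rcases R with _ | ⟨x', y', h'⟩
    · simp [coords]
    · simp only [coords_some, Affine.Point.xRep_some] at e ⊢
      simp at e ⊢
      exact .inr (by linear_combination -c * e)
  -- At a point sent to infinity `hcross` reads 0 = 0. The Weierstrass equation of the image, with
  -- one factor F₂ cancelled, instead gives F₁²g³ = 0 there with F₁ ≠ 0, hence g = 0.
  have hcurve : Vanishes E (F 1 ^ 2 * poly g ^ 3 - F 2 ^ 2 *
      (poly f ^ 3 + MvPolynomial.C E.a₄ * poly f * poly g ^ 2 +
        MvPolynomial.C E.a₆ * poly g ^ 3)) := by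
    refine (vanishes_or_vanishes (G := F 2) fun x y hxy => ?_).resolve_left hF2
    have h : E.toAffine.Nonsingular x y := Affine.equation_iff_nonsingular.mp hxy
    have hx := hcross x y hxy
    obtain ⟨c, hc⟩ := hQ (.some x y h)
    have e0 := congrFun hc 0
    have e1 := congrFun hc 1
    have e2 := congrFun hc 2
    simp only [coords_some, Pi.smul_apply, smul_eq_mul] at e0 e1 e2
    simp only [map_mul, map_sub, hpoly, map_add, map_pow, MvPolynomial.eval_C, e0, e1, e2] at hx ⊢
    generalize φ (.some x y h) = R at hx ⊢
    rcases R with _ | ⟨x', y', h'⟩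
    · simp [coords]
    · have heq := equation_iff_of_isShortNF.mp h'.1
      rw [eval_cubic] at heq
      simp only [coords_some] at hx ⊢
      simp at hx ⊢
      by_cases hc0 : c = 0
      · exact .inl hc0
      right
      have hx' : f.eval x = x' * g.eval x := by
        refine mul_left_cancel₀ hc0 ?_
        linear_combination -hx
      rw [hx']
      linear_combination c ^ 2 * g.eval x ^ 3 * heq
  have k1 := hcross x₀ y₀ h₀.1
  have k2 := hcurve x₀ y₀ h₀.1
  obtain ⟨c, hc⟩ := hQ (.some x₀ y₀ h₀)
  have hc0 : c ≠ 0 := IsRegularAt.ne_zero ⟨i, hi⟩ hc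
  have e0 := congrFun hc 0
  have e1 := congrFun hc 1
  have e2 := congrFun hc 2
  simp only [coords_some, Pi.smul_apply, smul_eq_mul] at e0 e1 e2
  simp only [map_mul, map_sub, hpoly, map_add, map_pow, MvPolynomial.eval_C, e0, e1, e2] at k1 k2
  generalize φ (.some x₀ y₀ h₀) = R at k1 k2 ⊢
  rcases R with _ | ⟨x', y', h'⟩
  · have : g.eval x₀ = 0 := by simpa [coords, hc0] using k2
    simp [← Affine.Point.zero_def, this]
  · simp only [coords_some, Affine.Point.xRep_some] at k1 ⊢
    simp at k1 ⊢
    refine mul_left_cancel₀ hc0 ?_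
    linear_combination -k1

end XRep

/-! ### Degrees of base-point-free tuples of polynomials. -/

section Primitive

open Polynomial

variable {K : Type*} [Field K]

/-- A tuple of polynomials of degree at most `m` whose homogenizations of degree `m` have no common
zero on the projective line. -/
structure IsPrimitive {ι : Type*} (m : ℕ) (v : ι → K[X]) : Prop where
  natDegree_le : ∀ i, (v i).natDegree ≤ m
  exists_eval_ne_zero : ∀ x, ∃ i, (v i).eval x ≠ 0
  exists_coeff_ne_zero : ∃ i, (v i).coeff m ≠ 0

/-- A generator of the ideal spanned by the entries has no root, hence is a unit. -/
theorem IsPrimitive.exists_sum_eq_one [IsAlgClosed K] {ι : Type*} [Fintype ι] {m : ℕ}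
    {v : ι → K[X]} (h : IsPrimitive m v) : ∃ s : ι → K[X], ∑ i, s i * v i = 1 := by
  rw [← Ideal.mem_span_range_iff_exists_fun]
  obtain ⟨d, hd⟩ := (IsPrincipalIdealRing.principal (Ideal.span (Set.range v))).principal
  have hdvd : ∀ i, d ∣ v i := fun i => by
    have : v i ∈ Ideal.span (Set.range v) := Ideal.subset_span ⟨i, rfl⟩
    rw [hd] at this
    exact Ideal.mem_span_singleton.mp this
  have hunit : IsUnit d := by
    by_contra hu
    obtain ⟨x, hx⟩ : ∃ x, d.eval x = 0 := by
      by_cases hd0 : d.degree = 0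
      · exact (hu (isUnit_iff_degree_eq_zero.mpr hd0)).elim
      · exact IsAlgClosed.exists_root d hd0
    obtain ⟨i, hi⟩ := h.exists_eval_ne_zero x
    exact hi (eval_eq_zero_of_dvd_of_eval_eq_zero (hdvd i) hx)
  rw [hd]
  exact Ideal.mem_span_singleton.mpr hunit.dvd

/-- A Bézout relation for v turns proportionality into w = r·v with r a polynomial. A root of r
would be a common zero of w, so r is a nonzero constant and the coefficient of v in degree m
survives in w. Hence the degree depends only on the map to projective space. -/
theorem IsPrimitive.le_of_proportional [IsAlgClosed K] {ι : Type*} [Fintype ι] {m n : ℕ}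
    {v w : ι → K[X]} (hv : IsPrimitive m v) (hw : IsPrimitive n w)
    (h : ∀ i j, v i * w j = v j * w i) : m ≤ n := by
  obtain ⟨s, hs⟩ := hv.exists_sum_eq_one
  set r := ∑ i, s i * w i with hr
  have hwr : ∀ j, w j = r * v j := fun j => by
    rw [← one_mul (w j), ← hs, hr, Finset.sum_mul, Finset.sum_mul]
    exact Finset.sum_congr rfl fun i _ => by linear_combination s i * h i j
  have hr0 : r.degree = 0 := by
    by_contra hd
    obtain ⟨x, hx⟩ := IsAlgClosed.exists_root r hd
    obtain ⟨i, hi⟩ := hw.exists_eval_ne_zero x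
    exact hi (by rw [hwr i, eval_mul, hx.eq_zero, zero_mul])
  obtain ⟨i, hi⟩ := hv.exists_coeff_ne_zero
  refine le_trans (le_natDegree_of_ne_zero ?_) (hw.natDegree_le i)
  have hr' := eq_C_of_degree_eq_zero hr0
  rw [hwr i, hr', coeff_C_mul]
  refine mul_ne_zero (fun h0 => ?_) hi
  rw [hr', h0, C_0, degree_zero] at hr0
  exact absurd hr0 (by simp)

theorem IsPrimitive.eq_of_proportional [IsAlgClosed K] {ι : Type*} [Fintype ι] {m n : ℕ}
    {v w : ι → K[X]} (hv : IsPrimitive m v) (hw : IsPrimitive n w)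
    (h : ∀ i j, v i * w j = v j * w i) : m = n :=
  le_antisymm (hv.le_of_proportional hw h)
    (hw.le_of_proportional hv fun i j => by linear_combination -h i j)

theorem isPrimitive_of_isCoprime {f g : K[X]} (h : IsCoprime f g) :
    IsPrimitive (max f.natDegree g.natDegree) ![f, g] := by
  obtain ⟨a, b, hab⟩ := h
  refine ⟨fun i => ?_, fun x => ?_, ?_⟩
  · fin_cases i <;> simp
  · by_contra! h0
    have h1 := congrArg (eval x) hab
    have hf : f.eval x = 0 := h0 0
    have hg : g.eval x = 0 := h0 1
    simp [hf, hg] at h1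
  · by_contra! h0
    have hf : f.coeff (max f.natDegree g.natDegree) = 0 := h0 0
    have hg : g.coeff (max f.natDegree g.natDegree) = 0 := h0 1
    have hf0 : f ≠ 0 ∨ g ≠ 0 := by
      by_contra! h1
      simp [h1.1, h1.2] at hab
    rcases le_total f.natDegree g.natDegree with hle | hle
    · rw [max_eq_right hle] at hf hg
      have hg0 : g = 0 := leadingCoeff_eq_zero.mp hg
      subst hg0
      have hf1 : f.natDegree = 0 := by simpa using hle
      rw [eq_C_of_natDegree_eq_zero hf1] at hf0
      simp at hf0 hf
      exact hf0 hf
    · rw [max_eq_left hle] at hf hg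
      have hf0' : f = 0 := leadingCoeff_eq_zero.mp hf
      subst hf0'
      have hg1 : g.natDegree = 0 := by simpa using hle
      rw [eq_C_of_natDegree_eq_zero hg1] at hf0
      simp at hf0 hg
      exact hf0 hg

/-- The symmetric functions of two points of the projective line. -/
def symSq {R : Type*} [CommRing R] (v w : Fin 2 → R) : Fin 3 → R :=
  ![v 0 * w 0, v 0 * w 1 + v 1 * w 0, v 1 * w 1]

/-- The quadratic map that takes the symmetric functions of `x(P)` and `x(Q)` to those of `x(P + Q)`
and `x(P - Q)` on the curve `y² = x³ + ax + b`. -/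
def addSub {R : Type*} [CommRing R] (a b : R) (v : Fin 3 → R) : Fin 3 → R :=
  ![(v 0 - a * v 2) ^ 2 - 4 * b * v 1 * v 2, 2 * v 1 * (a * v 2 + v 0) + 4 * b * v 2 ^ 2,
    v 1 ^ 2 - 4 * v 0 * v 2]

theorem symSq_smul {R : Type*} [CommRing R] (c d : R) (v w : Fin 2 → R) :
    symSq (c • v) (d • w) = (c * d) • symSq v w := by
  ext i
  fin_cases i <;> simp [symSq] <;> ring

theorem addSub_smul {R : Type*} [CommRing R] (a b c : R) (v : Fin 3 → R) :
    addSub a b (c • v) = c ^ 2 • addSub a b v := by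
  ext i
  fin_cases i <;> simp [addSub] <;> ring

theorem symSq_ne_zero {v w : Fin 2 → K} (hv : ∃ i, v i ≠ 0) (hw : ∃ i, w i ≠ 0) :
    ∃ i, symSq v w i ≠ 0 := by
  by_contra! h
  have h0 : v 0 * w 0 = 0 := h 0
  have h1 : v 0 * w 1 + v 1 * w 0 = 0 := h 1
  have h2 : v 1 * w 1 = 0 := h 2
  simp only [Fin.exists_fin_two] at hv hw
  grind

/-- Nonvanishing of the discriminant is what leaves the quadratic map without base points, so that
it exactly doubles degrees. -/
theorem addSub_ne_zero {a b : K} (hab : -16 * (4 * a ^ 3 + 27 * b ^ 2) ≠ 0) {v : Fin 3 → K}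
    (hv : ∃ i, v i ≠ 0) : ∃ i, addSub a b v i ≠ 0 := by
  by_contra! h
  have h0 : (v 0 - a * v 2) ^ 2 - 4 * b * v 1 * v 2 = 0 := h 0
  have h1 : 2 * v 1 * (a * v 2 + v 0) + 4 * b * v 2 ^ 2 = 0 := h 1
  have h2 : v 1 ^ 2 - 4 * v 0 * v 2 = 0 := h 2
  have hz : v 2 = 0 := by
    have key : -16 * (4 * a ^ 3 + 27 * b ^ 2) * v 2 ^ 4 = 0 := by
      -- An elimination certificate: the discriminant times v₂⁴ lies in the ideal of the three
      -- quadratic forms.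
      linear_combination (-12 * v 1 ^ 2 - 64 * a * v 2 ^ 2) * h0 +
        (6 * v 0 * v 1 - 10 * a * v 1 * v 2 - 108 * b * v 2 ^ 2) * h1 +
        (-16 * a * v 0 * v 2 - 48 * b * v 1 * v 2 + 32 * a ^ 2 * v 2 ^ 2) * h2
    exact (pow_eq_zero_iff four_ne_zero).mp ((mul_eq_zero.mp key).resolve_left hab)
  have hy : v 1 = 0 := by simpa [hz] using h2
  have hx : v 0 = 0 := by simpa [hz] using h0
  obtain ⟨i, hi⟩ := hv
  fin_cases i
  · exact hi hx
  · exact hi hy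
  · exact hi hz

theorem IsPrimitive.symSq {m n : ℕ} {v w : Fin 2 → K[X]} (hv : IsPrimitive m v)
    (hw : IsPrimitive n w) : IsPrimitive (m + n) (symSq v w) := by
  have hd : ∀ i j, (v i * w j).natDegree ≤ m + n := fun i j =>
    natDegree_mul_le_of_le (hv.natDegree_le i) (hw.natDegree_le j)
  have hc : ∀ i j, (v i * w j).coeff (m + n) = (v i).coeff m * (w j).coeff n := fun i j =>
    coeff_mul_add_eq_of_natDegree_le (hv.natDegree_le i) (hw.natDegree_le j)
  refine ⟨fun i => ?_, fun x => ?_, ?_⟩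
  · fin_cases i
    · exact hd 0 0
    · exact natDegree_add_le_of_degree_le (hd 0 1) (hd 1 0)
    · exact hd 1 1
  · obtain ⟨i, hi⟩ := symSq_ne_zero (hv.exists_eval_ne_zero x) (hw.exists_eval_ne_zero x)
    refine ⟨i, ?_⟩
    convert hi using 1
    fin_cases i <;> simp [EllCurve.symSq]
  · obtain ⟨i, hi⟩ := symSq_ne_zero hv.exists_coeff_ne_zero hw.exists_coeff_ne_zero
    refine ⟨i, ?_⟩
    convert hi using 1
    fin_cases i <;> simp [EllCurve.symSq, hc]

theorem IsPrimitive.addSub {a b : K} (hab : -16 * (4 * a ^ 3 + 27 * b ^ 2) ≠ 0) {m : ℕ}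
    {v : Fin 3 → K[X]} (hv : IsPrimitive m v) : IsPrimitive (m + m) (addSub (C a) (C b) v) := by
  have hd : ∀ i j, (v i * v j).natDegree ≤ m + m := fun i j =>
    natDegree_mul_le_of_le (hv.natDegree_le i) (hv.natDegree_le j)
  have hc : ∀ i j, (v i * v j).coeff (m + m) = (v i).coeff m * (v j).coeff m := fun i j =>
    coeff_mul_add_eq_of_natDegree_le (hv.natDegree_le i) (hv.natDegree_le j)
  have hdC : ∀ (c : K) i j, (C c * (v i * v j)).natDegree ≤ m + m := fun c i j =>
    (natDegree_C_mul_le _ _).trans (hd i j)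
  -- Expanded into multiples of products vᵢvⱼ, so that `hd` bounds the degrees and `hc` computes the
  -- top coefficients termwise.
  have e : EllCurve.addSub (C a) (C b) v = ![v 0 * v 0 + C (-2 * a) * (v 0 * v 2) +
      C (a ^ 2) * (v 2 * v 2) + C (-4 * b) * (v 1 * v 2),
      C (2 * a) * (v 1 * v 2) + C 2 * (v 1 * v 0) + C (4 * b) * (v 2 * v 2),
      v 1 * v 1 + C (-4) * (v 0 * v 2)] := by
    ext1 i
    have h2 : (C 2 : K[X]) = 2 := C_ofNat 2
    have h4 : (C 4 : K[X]) = 4 := C_ofNat 4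
    fin_cases i <;> simp [EllCurve.addSub, h2, h4] <;> ring
  refine ⟨fun i => ?_, fun x => ?_, ?_⟩
  · rw [e]
    fin_cases i
    · exact natDegree_add_le_of_degree_le (natDegree_add_le_of_degree_le
        (natDegree_add_le_of_degree_le (hd _ _) (hdC _ _ _)) (hdC _ _ _)) (hdC _ _ _)
    · exact natDegree_add_le_of_degree_le (natDegree_add_le_of_degree_le (hdC _ _ _) (hdC _ _ _))
        (hdC _ _ _)
    · exact natDegree_add_le_of_degree_le (hd _ _) (hdC _ _ _)
  · obtain ⟨i, hi⟩ := addSub_ne_zero hab (hv.exists_eval_ne_zero x)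
    refine ⟨i, ?_⟩
    convert hi using 1
    fin_cases i <;> simp [EllCurve.addSub]
  · obtain ⟨i, hi⟩ := addSub_ne_zero hab hv.exists_coeff_ne_zero
    refine ⟨i, ?_⟩
    convert hi using 1
    rw [e]
    fin_cases i <;> simp only [coeff_add, coeff_C_mul, hc, EllCurve.addSub, Fin.zero_eta,
      Matrix.cons_val, Fin.mk_one, Fin.reduceFinMk] <;> ring

/-- The value at `(s, t)` of the homogenization of degree `n` of the polynomial `f`. -/
noncomputable def homog {R : Type*} [CommRing R] [Algebra K R] (n : ℕ) (f : K[X]) (s t : R) : R :=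
  ∑ i ∈ Finset.range (n + 1), algebraMap K R (f.coeff i) * (s ^ i * t ^ (n - i))

theorem homog_of_ne_zero {n : ℕ} {f : K[X]} (hf : f.natDegree ≤ n) (s : K) {t : K} (ht : t ≠ 0) :
    homog n f s t = t ^ n * f.eval (s / t) := by
  rw [homog, eval_eq_sum_range' (Nat.lt_succ_of_le hf), Finset.mul_sum]
  refine Finset.sum_congr rfl fun i hi => ?_
  have hi' : i ≤ n := Nat.lt_succ_iff.mp (Finset.mem_range.mp hi)
  have : t ^ n = t ^ (n - i) * t ^ i := by rw [← pow_add, Nat.sub_add_cancel hi']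
  rw [this, div_pow]
  simp only [Algebra.algebraMap_self, RingHom.id_apply]
  field_simp

theorem homog_zero_right (n : ℕ) (f : K[X]) (s : K) : homog n f s 0 = f.coeff n * s ^ n := by
  rw [homog, Finset.sum_range_succ, Finset.sum_eq_zero]
  · simp
  · intro i hi
    have : n - i ≠ 0 := by have := Finset.mem_range.mp hi; omega
    simp [this]

theorem homog_ne_zero {n : ℕ} {v : Fin 2 → K[X]} (hv : IsPrimitive n v) {w : Fin 2 → K}
    (hw : ∃ i, w i ≠ 0) : ∃ i, homog n (v i) (w 0) (w 1) ≠ 0 := by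
  by_cases h1 : w 1 = 0
  · have h0 : w 0 ≠ 0 := by
      rw [Fin.exists_fin_two] at hw
      exact hw.resolve_right (fun h => h h1)
    obtain ⟨i, hi⟩ := hv.exists_coeff_ne_zero
    refine ⟨i, ?_⟩
    rw [h1, homog_zero_right]
    exact mul_ne_zero hi (pow_ne_zero _ h0)
  · obtain ⟨i, hi⟩ := hv.exists_eval_ne_zero (w 0 / w 1)
    refine ⟨i, ?_⟩
    rw [homog_of_ne_zero (hv.natDegree_le i) _ h1]
    exact mul_ne_zero (pow_ne_zero _ h1) hi

theorem eval_homog (n : ℕ) (f s t : K[X]) (x : K) :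
    (homog n f s t).eval x = homog n f (s.eval x) (t.eval x) := by
  simp [homog, eval_finsetSum]

theorem natDegree_homog_le {n m : ℕ} (f : K[X]) {s t : K[X]} (hs : s.natDegree ≤ m)
    (ht : t.natDegree ≤ m) : (homog n f s t).natDegree ≤ n * m := by
  refine natDegree_sum_le_of_forall_le _ _ fun i hi => ?_
  refine (natDegree_C_mul_le _ _).trans ?_
  refine (natDegree_mul_le_of_le (natDegree_pow_le_of_le i hs)
    (natDegree_pow_le_of_le (n - i) ht)).trans ?_
  rw [← add_mul, Nat.add_sub_cancel' (Nat.lt_succ_iff.mp (Finset.mem_range.mp hi))]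

theorem coeff_homog {n m : ℕ} (f : K[X]) {s t : K[X]} (hs : s.natDegree ≤ m)
    (ht : t.natDegree ≤ m) :
    (homog n f s t).coeff (n * m) = homog n f (s.coeff m) (t.coeff m) := by
  rw [homog, homog, finsetSum_coeff]
  refine Finset.sum_congr rfl fun i hi => ?_
  have hi' : i + (n - i) = n := Nat.add_sub_cancel' (Nat.lt_succ_iff.mp (Finset.mem_range.mp hi))
  have : n * m = i * m + (n - i) * m := by rw [← add_mul, hi']
  rw [this]
  erw [coeff_C_mul]
  rw [coeff_mul_add_eq_of_natDegree_le (natDegree_pow_le_of_le i hs)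
    (natDegree_pow_le_of_le (n - i) ht), coeff_pow_of_natDegree_le hs,
    coeff_pow_of_natDegree_le ht]
  rfl

/-- Composition of self-maps of the projective line: no common zero can arise, at finite points or
at infinity, so the degrees multiply without cancellation. -/
theorem IsPrimitive.homog {m n : ℕ} {v w : Fin 2 → K[X]} (hv : IsPrimitive n v)
    (hw : IsPrimitive m w) : IsPrimitive (n * m) fun i => homog n (v i) (w 0) (w 1) := by
  refine ⟨fun i => natDegree_homog_le _ (hw.natDegree_le 0) (hw.natDegree_le 1), fun x => ?_, ?_⟩
  · simp only [eval_homog]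
    exact homog_ne_zero hv (hw.exists_eval_ne_zero x)
  · simp only [coeff_homog _ (hw.natDegree_le 0) (hw.natDegree_le 1)]
    exact homog_ne_zero hv hw.exists_coeff_ne_zero

end Primitive

/-! ### The degree as a multiplicative, definite quadratic form on endomorphisms. -/

section Degree

open Polynomial

variable {K : Type*} [Field K] {E : WeierstrassCurve K}

theorem exists_eq_smul_xRep (P : E.toAffine.Point) {v : Fin 2 → K}
    (h : v 0 * P.xRep 1 = v 1 * P.xRep 0) : ∃ c : K, v = c • P.xRep := by
  rcases P with _ | ⟨x, y, hxy⟩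
  · rw [← Affine.Point.zero_def] at h ⊢
    refine ⟨v 0, funext fun i => ?_⟩
    fin_cases i
    · simp
    · simpa using h.symm
  · refine ⟨v 1, funext fun i => ?_⟩
    fin_cases i
    · simpa using h
    · simp

variable [DecidableEq K]

/-- The symmetric functions of `x(P + Q)` and `x(P - Q)` in terms of those of `x(P)` and `x(Q)`. -/
theorem addSub_symSq_xRep [E.IsShortNF] (P Q : E.toAffine.Point) :
    ∃ c : K, addSub E.a₄ E.a₆ (symSq P.xRep Q.xRep) = c • symSq (P + Q).xRep (P - Q).xRep := by
  rcases P with _ | ⟨x₁, y₁, h₁⟩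
  -- This expression equals 1 both at (1, 0) and at (x, 1), so it serves both cases of Q.
  · refine ⟨Q.xRep 1 ^ 2 + Q.xRep 0 ^ 2 - Q.xRep 0 ^ 2 * Q.xRep 1 ^ 2, ?_⟩
    rw [← Affine.Point.zero_def, zero_add, zero_sub, Affine.Point.xRep_neg]
    rcases Q with _ | ⟨x₂, y₂, h₂⟩
    · rw [← Affine.Point.zero_def]
      ext i
      fin_cases i <;> simp [addSub, symSq]
    · ext i
      fin_cases i <;> simp [addSub, symSq] <;> ring
  rcases Q with _ | ⟨x₂, y₂, h₂⟩
  · refine ⟨1, ?_⟩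
    rw [← Affine.Point.zero_def, add_zero, sub_zero]
    ext i
    fin_cases i <;> simp [addSub, symSq] <;> ring
  have e₁ := equation_iff_of_isShortNF.mp h₁.1
  have e₂ := equation_iff_of_isShortNF.mp h₂.1
  rw [eval_cubic] at e₁ e₂
  rw [sub_eq_add_neg, Affine.Point.neg_some]
  by_cases hx : x₁ = x₂
  · subst hx
    have double : ∀ y (h : E.toAffine.Nonsingular x₁ y),
        ∃ c : K, addSub E.a₄ E.a₆ (symSq ![x₁, 1] ![x₁, 1]) =
          c • symSq (Affine.Point.some x₁ y h + Affine.Point.some x₁ y h).xRep ![1, 0] := by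
      intro y h
      have e := equation_iff_of_isShortNF.mp h.1
      rw [eval_cubic] at e
      by_cases hy : y = E.toAffine.negY x₁ y
      · rw [Affine.Point.add_self_of_Y_eq hy]
        rw [negY_of_isShortNF] at hy
        refine ⟨(x₁ ^ 2 - E.a₄) ^ 2 - 8 * E.a₆ * x₁, ?_⟩
        ext i
        fin_cases i
        · simp [addSub, symSq]; ring
        · simp [addSub, symSq]; linear_combination -4 * e + 2 * y * hy
        · simp [addSub, symSq]; ring
      · rw [Affine.Point.add_self_of_Y_ne hy, Affine.Point.xRep_some, Affine.slope_of_Y_ne rfl hy]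
        rw [negY_of_isShortNF] at hy ⊢
        refine ⟨(2 * y) ^ 2, ?_⟩
        have hy2 : y - -y ≠ 0 := sub_ne_zero.mpr hy
        have hy2' : 2 * y ≠ 0 := by rwa [two_mul, ← sub_neg_eq_add]
        have hy0 : y ≠ 0 := right_ne_zero_of_mul hy2'
        have h2 : (2 : K) ≠ 0 := left_ne_zero_of_mul hy2'
        ext i
        fin_cases i
        · simp [addSub, symSq, Affine.addX, ← two_mul]
          field_simp
          linear_combination 8 * x₁ * e
        · simp [addSub, symSq]; linear_combination -4 * e
        · simp [addSub, symSq]; ring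
    rcases Affine.Y_eq_of_X_eq h₁.1 h₂.1 rfl with hy | hy
    · subst hy
      obtain ⟨c, hc⟩ := double y₁ h₁
      refine ⟨c, ?_⟩
      rw [Affine.Point.add_of_Y_eq (y₂ := E.toAffine.negY x₁ y₁) rfl
        (Affine.negY_negY x₁ y₁).symm]
      simpa using hc
    · have hy' : E.toAffine.negY x₁ y₂ = y₁ := hy.symm
      subst hy'
      obtain ⟨c, hc⟩ := double _ h₁
      refine ⟨c, ?_⟩
      rw [Affine.Point.add_of_Y_eq (y₂ := y₂) rfl rfl]
      simp only [Affine.Point.xRep_some, Affine.Point.xRep_zero] at hc ⊢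
      rw [hc]
      congr 1
      ext i
      fin_cases i <;> simp [symSq, mul_comm]
  · rw [Affine.Point.add_of_X_ne hx, Affine.Point.add_of_X_ne hx, Affine.Point.xRep_some,
      Affine.Point.xRep_some, Affine.Point.xRep_some, Affine.Point.xRep_some,
      Affine.slope_of_X_ne hx, Affine.slope_of_X_ne hx, negY_of_isShortNF]
    refine ⟨(x₁ - x₂) ^ 2, ?_⟩
    have hx' : x₁ - x₂ ≠ 0 := sub_ne_zero.mpr hx
    ext i
    fin_cases i
    · simp [addSub, symSq, Affine.addX]
      field_simp
      linear_combination -(y₁ ^ 2 + (x₁ ^ 3 + E.a₄ * x₁ + E.a₆) - 2 * y₂ ^ 2 -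
        2 * (x₁ + x₂) * (x₁ - x₂) ^ 2) * e₁ - (y₂ ^ 2 + (x₂ ^ 3 + E.a₄ * x₂ + E.a₆) -
        2 * (x₁ ^ 3 + E.a₄ * x₁ + E.a₆) - 2 * (x₁ + x₂) * (x₁ - x₂) ^ 2) * e₂
    · simp [addSub, symSq, Affine.addX]
      field_simp
      linear_combination -2 * e₁ - 2 * e₂
    · simp [addSub, symSq]; ring

theorem IsXRep.exists_smul {φ : AddMonoid.End E.toAffine.Point} {v : Fin 2 → K[X]}
    (h : IsXRep φ (v 0) (v 1)) {x y : K} (hxy : E.toAffine.Nonsingular x y) :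
    ∃ c : K, (fun i => (v i).eval x) = c • (φ (.some x y hxy)).xRep :=
  exists_eq_smul_xRep _ (h x y hxy)

variable [IsAlgClosed K] [E.IsShortNF] [E.IsElliptic]

theorem exists_isPrimitive_isXRep (φ : endRing E) :
    ∃ (m : ℕ) (v : Fin 2 → K[X]), IsPrimitive m v ∧ IsXRep φ.1 (v 0) (v 1) := by
  obtain ⟨f, g, hfg, h⟩ := exists_isXRep φ.2
  exact ⟨_, ![f, g], isPrimitive_of_isCoprime hfg, h⟩

/-- The degree of an endomorphism of a short Weierstrass curve: the degree of the map of the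
projective line it induces on `x`-coordinates, and `0` for the zero endomorphism. -/
noncomputable def deg (φ : endRing E) : ℕ := (exists_isPrimitive_isXRep φ).choose

theorem exists_isXRep_deg (φ : endRing E) :
    ∃ v : Fin 2 → K[X], IsPrimitive (deg φ) v ∧ IsXRep φ.1 (v 0) (v 1) :=
  (exists_isPrimitive_isXRep φ).choose_spec

/-- Proportionality is a polynomial identity, so the roots of d may be ignored. Composition needs
this freedom at the poles of the inner map. -/
theorem deg_eq_of_forall_eval {φ : endRing E} {m : ℕ} {w : Fin 2 → K[X]} (hw : IsPrimitive m w)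
    {d : K[X]} (hd : d ≠ 0) (h : ∀ x y (hxy : E.toAffine.Nonsingular x y), d.eval x ≠ 0 →
      (w 0).eval x * (φ.1 (.some x y hxy)).xRep 1 = (w 1).eval x * (φ.1 (.some x y hxy)).xRep 0) :
    deg φ = m := by
  obtain ⟨v, hv, hφ⟩ := exists_isXRep_deg φ
  refine hv.eq_of_proportional hw fun i j => ?_
  refine mul_left_cancel₀ hd (Polynomial.funext fun x => ?_)
  by_cases hdx : d.eval x = 0
  · simp [hdx]
  obtain ⟨y, hxy⟩ := exists_affine_point (E := E) x
  obtain ⟨c, hc⟩ := hφ.exists_smul hxy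
  obtain ⟨c', hc'⟩ := exists_eq_smul_xRep (v := fun i => (w i).eval x) _ (h x y hxy hdx)
  have e : ∀ i, (v i).eval x = c * (φ.1 (.some x y hxy)).xRep i := fun i => congrFun hc i
  have e' : ∀ i, (w i).eval x = c' * (φ.1 (.some x y hxy)).xRep i := fun i => congrFun hc' i
  simp only [eval_mul, e, e']
  ring

theorem deg_eq_of_isXRep {φ : endRing E} {m : ℕ} {w : Fin 2 → K[X]} (hw : IsPrimitive m w)
    (h : IsXRep φ.1 (w 0) (w 1)) : deg φ = m :=
  deg_eq_of_forall_eval hw one_ne_zero fun x y hxy _ => h x y hxy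

/-- The symmetric functions of the x-coordinates of φ + ψ and φ - ψ have two primitive
presentations: directly, in degree deg(φ + ψ) + deg(φ - ψ), and through `addSub`, in degree 2(deg φ
+ deg ψ). Proportional primitive tuples have equal degree. -/
theorem deg_add_add_deg_sub (φ ψ : endRing E) :
    deg (φ + ψ) + deg (φ - ψ) = 2 * deg φ + 2 * deg ψ := by
  obtain ⟨v, hv, hφ⟩ := exists_isXRep_deg φ
  obtain ⟨w, hw, hψ⟩ := exists_isXRep_deg ψ
  obtain ⟨v', hv', hadd⟩ := exists_isXRep_deg (φ + ψ)
  obtain ⟨w', hw', hsub⟩ := exists_isXRep_deg (φ - ψ)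
  have key := (hv'.symSq hw').eq_of_proportional ((hv.symSq hw).addSub (discr_ne_zero E)) ?_
  · omega
  intro i j
  refine Polynomial.funext fun x => ?_
  obtain ⟨y, hxy⟩ := exists_affine_point (E := E) x
  obtain ⟨c₁, h₁⟩ := hφ.exists_smul hxy
  obtain ⟨c₂, h₂⟩ := hψ.exists_smul hxy
  obtain ⟨c₃, h₃⟩ := hadd.exists_smul hxy
  obtain ⟨c₄, h₄⟩ := hsub.exists_smul hxy
  have e₃ : (φ + ψ).1 (.some x y hxy) = φ.1 (.some x y hxy) + ψ.1 (.some x y hxy) := rfl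
  have e₄ : (φ - ψ).1 (.some x y hxy) = φ.1 (.some x y hxy) - ψ.1 (.some x y hxy) := rfl
  rw [e₃] at h₃
  rw [e₄] at h₄
  set P := φ.1 (.some x y hxy)
  set Q := ψ.1 (.some x y hxy)
  obtain ⟨c, hc⟩ := addSub_symSq_xRep P Q
  have hl : ∀ i, (symSq v' w' i).eval x = c₃ * c₄ * symSq (P + Q).xRep (P - Q).xRep i := by
    intro i
    have : (symSq v' w' i).eval x =
        symSq (fun i => (v' i).eval x) (fun i => (w' i).eval x) i := by
      fin_cases i <;> simp [symSq]
    rw [this, h₃, h₄, symSq_smul]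
    rfl
  have hr : ∀ i, (addSub (C E.a₄) (C E.a₆) (symSq v w) i).eval x =
      (c₁ * c₂) ^ 2 * c * symSq (P + Q).xRep (P - Q).xRep i := by
    intro i
    have : (addSub (C E.a₄) (C E.a₆) (symSq v w) i).eval x = addSub E.a₄ E.a₆
        (symSq (fun i => (v i).eval x) (fun i => (w i).eval x)) i := by
      fin_cases i <;> simp [symSq, addSub]
    rw [this, h₁, h₂, symSq_smul, addSub_smul, hc, mul_assoc]
    rfl
  simp only [eval_mul, hl, hr]
  ring

theorem deg_zero : deg (0 : endRing E) = 0 := by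
  refine deg_eq_of_isXRep (w := ![1, 0]) ⟨fun i => ?_, fun x => ⟨0, by simp⟩, 0, by simp⟩ ?_
  · fin_cases i <;> simp
  · intro x y h
    simp

/-- The induced map on x-coordinates is constant. If the constant is finite, no affine point lies in
the kernel, so φ is injective; yet points with x = 0 and x = 1 have images equal up to sign. -/
theorem eq_zero_of_deg_eq_zero {φ : endRing E} (h : deg φ = 0) : φ = 0 := by
  obtain ⟨v, hv, hφ⟩ := exists_isXRep_deg φ
  rw [h] at hv
  have hc : ∀ i, ∃ c, v i = C c := fun i =>
    ⟨_, eq_C_of_natDegree_eq_zero (Nat.le_zero.mp (hv.natDegree_le i))⟩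
  choose c hc using hc
  have hφ' : ∀ x y (h : E.toAffine.Nonsingular x y),
      c 0 * (φ.1 (.some x y h)).xRep 1 = c 1 * (φ.1 (.some x y h)).xRep 0 := by
    intro x y h
    simpa [hc] using hφ x y h
  by_cases h1 : c 1 = 0
  · have h0 : c 0 ≠ 0 := by
      obtain ⟨i, hi⟩ := hv.exists_eval_ne_zero 0
      fin_cases i
      · simpa [hc] using hi
      · simp [hc, h1] at hi
    refine Subtype.ext (AddMonoidHom.ext fun P => ?_)
    rcases P with _ | ⟨x, y, hxy⟩
    · exact map_zero φ.1
    · have := hφ' x y hxy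
      simp only [h1, zero_mul, mul_eq_zero, h0, false_or] at this
      change φ.1 (.some x y hxy) = 0
      rcases hR : φ.1 (.some x y hxy) with _ | ⟨x', y', h'⟩
      · rfl
      · simp [hR] at this
  · exfalso
    have hne : ∀ x y (h : E.toAffine.Nonsingular x y),
        (φ.1 (.some x y h)).xRep = ![c 0 / c 1, 1] := by
      intro x y h
      have := hφ' x y h
      rcases hR : φ.1 (.some x y h) with _ | ⟨x', y', h'⟩
      · simp [hR, ← Affine.Point.zero_def] at this
        exact (h1 this.symm).elim
      · simp [hR] at this
        simp [this, h1]
    have hinj : ∀ P, φ.1 P = 0 → P = 0 := by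
      rintro (_ | ⟨x, y, h⟩) hP
      · rfl
      · have := hne x y h
        rw [hP] at this
        simpa using congrFun this 1
    obtain ⟨y₀, h₀⟩ := exists_affine_point (E := E) 0
    obtain ⟨y₁, h₁⟩ := exists_affine_point (E := E) 1
    have hx := (hne 0 y₀ h₀).trans (hne 1 y₁ h₁).symm
    have : (0 : K) = 1 := by
      rcases Affine.Point.eq_or_eq_neg_of_xRep_eq_xRep hx with h | h
      · have := hinj (.some 0 y₀ h₀ - .some 1 y₁ h₁) (by rw [map_sub, h, sub_self])
        exact (Affine.Point.some.inj (sub_eq_zero.mp this)).1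
      · have := hinj (.some 0 y₀ h₀ + .some 1 y₁ h₁) (by rw [map_add, h, neg_add_cancel])
        exact (Affine.Point.some.inj (eq_neg_of_add_eq_zero_left this)).1
    exact zero_ne_one this

theorem deg_one : deg (1 : endRing E) = 1 := by
  refine deg_eq_of_isXRep (w := ![X, 1]) ⟨fun i => ?_, fun x => ⟨1, by simp⟩, 0, by simp⟩ ?_
  · fin_cases i <;> simp
  · intro x y h
    simp

theorem deg_mul (φ ψ : endRing E) : deg (φ * ψ) = deg φ * deg ψ := by
  obtain ⟨v, hv, hφ⟩ := exists_isXRep_deg φ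
  obtain ⟨w, hw, hψ⟩ := exists_isXRep_deg ψ
  by_cases hw1 : w 1 = 0
  · have : ψ = 0 := by
      refine Subtype.ext (eq_zero_of_eval_ne_zero (N := 1) one_ne_zero fun x y h _ => ?_)
      have hx := hψ x y h
      obtain ⟨i, hi⟩ := hw.exists_eval_ne_zero x
      have h0 : (w 0).eval x ≠ 0 := by
        fin_cases i
        · exact hi
        · simp [hw1] at hi
      rw [hw1, eval_zero, zero_mul, mul_eq_zero, or_iff_right h0] at hx
      rcases hR : ψ.1 (.some x y h) with _ | ⟨x', y', h'⟩
      · rfl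
      · simp [hR] at hx
    rw [this, mul_zero, deg_zero, mul_zero]
  refine deg_eq_of_forall_eval (hv.homog hw) hw1 fun x y hxy hx => ?_
  obtain ⟨c, hc⟩ := hψ.exists_smul hxy
  have e : (φ * ψ).1 (.some x y hxy) = φ.1 (ψ.1 (.some x y hxy)) := rfl
  rw [e, eval_homog, eval_homog]
  have h0 := congrFun hc 0
  have h1 := congrFun hc 1
  rcases hR : ψ.1 (.some x y hxy) with _ | ⟨x', y', h'⟩
  · rw [hR, ← Affine.Point.zero_def] at h1
    simp at h1
    exact (hx h1).elim
  · rw [hR] at h0 h1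
    simp at h0 h1
    have hc0 : c ≠ 0 := h1 ▸ hx
    rw [h0, h1, homog_of_ne_zero (hv.natDegree_le 0) _ hc0,
      homog_of_ne_zero (hv.natDegree_le 1) _ hc0, mul_div_cancel_left₀ _ hc0]
    linear_combination c ^ deg φ * hφ x' y' h'

theorem deg_neg (φ : endRing E) : deg (-φ) = deg φ := by
  have h := deg_add_add_deg_sub 0 φ
  rw [zero_add, zero_sub, deg_zero] at h
  omega

theorem deg_intCast (n : ℤ) : (deg (n : endRing E) : ℤ) = n ^ 2 := by
  -- The parallelogram law with 1 is a second-order recurrence in n, so two consecutive values are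
  -- carried.
  have hnat : ∀ n : ℕ, (deg (n : endRing E) : ℤ) = n ^ 2 ∧
      (deg ((n : endRing E) + 1) : ℤ) = (n + 1) ^ 2 := by
    intro n
    induction n with
    | zero => simp [deg_zero, deg_one]
    | succ n ih =>
      have h := deg_add_add_deg_sub ((n : endRing E) + 1) 1
      rw [add_sub_cancel_right, deg_one] at h
      push_cast
      refine ⟨ih.2, ?_⟩
      have h' : (deg ((n : endRing E) + 1 + 1) : ℤ) + deg (n : endRing E) =
        2 * deg ((n : endRing E) + 1) + 2 * 1 := by exact_mod_cast h
      linear_combination h' - ih.1 + 2 * ih.2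
  obtain ⟨m, rfl | rfl⟩ := n.eq_nat_or_neg
  · simpa using (hnat m).1
  · rw [Int.cast_neg, deg_neg]
    simpa using (hnat m).1

end Degree

/-! ### Characteristic equations from a norm satisfying the parallelogram law. -/

section Norm

variable {R : Type*} [Ring R]

/-- The polar form of a norm that satisfies the parallelogram law. -/
def polarHom (N : R → ℤ) (hpar : ∀ x y, N (x + y) + N (x - y) = 2 * N x + 2 * N y) (y : R) :
    R →+ ℤ :=
  AddMonoidHom.mk' (fun x => N (x + y) - N x - N y) fun x z => by
    -- The Jordan–von Neumann argument: in h1 + h2 - h3 only x + y + z and pairwise terms remain,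
    -- and h4 trades x - z for x + z.
    have h1 := hpar (x + y) z
    have h2 := hpar (z + y) x
    have h3 := hpar y (x - z)
    have h4 := hpar x z
    have e1 : x + y + z = x + z + y := by abel
    have e2 : z + y + x = x + z + y := by abel
    have e3 : x + y - z = y + (x - z) := by abel
    have e4 : z + y - x = y - (x - z) := by abel
    rw [e1, e3] at h1
    rw [e2, e4] at h2
    linarith

/-- In a ring with a multiplicative definite norm that satisfies the parallelogram law every element
is a root of its characteristic polynomial. -/
theorem mul_self_sub_trace_add_norm {N : R → ℤ}
    (hpar : ∀ x y, N (x + y) + N (x - y) = 2 * N x + 2 * N y) (hmul : ∀ x y, N (x * y) = N x * N y)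
    (hone : N 1 = 1) (hdef : ∀ x, N x = 0 → x = 0) (x : R) :
    x * x - (N (x + 1) - N x - 1) • x + N x • (1 : R) = 0 := by
  set b := polarHom N hpar with hb
  have b_apply : ∀ x y, b y x = N (x + y) - N x - N y := fun x y => rfl
  have b_comm : ∀ x y, b y x = b x y := fun x y => by
    rw [b_apply, b_apply, add_comm x y]; ring
  have b_mul : ∀ x y z, b (y * z) (x * z) = b y x * N z := fun x y z => by
    rw [b_apply, b_apply, ← add_mul, hmul, hmul, hmul]; ring
  have b_self : ∀ x, b x x = 2 * N x := fun x => by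
    have h0 : N 0 = 0 := by
      have := hpar 0 0
      simp at this
      linarith
    have := hpar x x
    rw [sub_self, h0] at this
    rw [b_apply]
    linarith
  -- Polarization of `b_mul` in its right factor.
  have b_mul_mul : ∀ x y z w, b (y * w) (x * z) + b (y * z) (x * w) = b y x * b w z := by
    intro x y z w
    have h := b_mul x y (z + w)
    have e1 : b (y * (z + w)) (x * (z + w)) = b (y * z) (x * z) + b (y * w) (x * z) +
        (b (y * z) (x * w) + b (y * w) (x * w)) := by
      rw [mul_add x, map_add, b_comm (x * z), b_comm (x * w), mul_add, map_add, map_add,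
        b_comm (y * z) (x * z), b_comm (y * w) (x * z), b_comm (y * z) (x * w),
        b_comm (y * w) (x * w)]
    rw [e1, b_mul, b_mul] at h
    rw [b_apply z w]
    linarith
  set t := N (x + 1) - N x - 1 with ht
  have ht' : b 1 x = t := by rw [b_apply, hone]
  set v := x * x - t • x + N x • (1 : R) with hv
  -- The characteristic expression v is orthogonal to everything, in particular to itself, so 2·N v
  -- = 0 and definiteness finishes.
  have key : ∀ w, b w v = 0 := by
    intro w
    have h1 := b_mul_mul x w x 1
    rw [mul_one, mul_one, ht'] at h1
    have h2 := b_mul 1 w x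
    rw [one_mul] at h2
    rw [hv, map_add, map_sub, map_zsmul, map_zsmul, smul_eq_mul, smul_eq_mul]
    linarith
  refine hdef v ?_
  have := key v
  rw [b_self] at this
  linarith

end Norm

/-! ### The shape of injective endomorphisms. -/

section Injective

open Polynomial

variable {K : Type*} [Field K]

theorem cubic_separable (E : WeierstrassCurve K) [E.IsShortNF] [E.IsElliptic] :
    (cubic E).Separable := by
  have h0 := discr_ne_zero E
  set d := -16 * (4 * E.a₄ ^ 3 + 27 * E.a₆ ^ 2) with hd
  have hC : C d * C d⁻¹ = 1 := by rw [← C_mul, mul_inv_cancel₀ h0, C_1]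
  have hder : derivative (cubic E) = 3 * X ^ 2 + C E.a₄ := by
    simp only [cubic, derivative_add, derivative_mul, derivative_X_pow, derivative_C, derivative_X]
    simp only [mul_one, zero_mul, zero_add, add_zero]
    norm_num
    exact C_ofNat 3
  -- From f'·(6a₄x² - 9a₆x + 4a₄²) - f·(18a₄x - 27a₆) = 4a₄³ + 27a₆², scaled by -16/d.
  refine ⟨C d⁻¹ * (-16) * (18 * C E.a₄ * X - 27 * C E.a₆) * (-1),
    C d⁻¹ * (-16) * (6 * C E.a₄ * X ^ 2 - 9 * C E.a₆ * X + 4 * C E.a₄ ^ 2), ?_⟩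
  have hdC : C d = -16 * (4 * C E.a₄ ^ 3 + 27 * C E.a₆ ^ 2) := by
    simp only [hd, map_mul, map_neg, map_add, map_pow, map_ofNat]
  rw [hder, cubic]
  linear_combination hC - C d⁻¹ * hdC

/-- By injectivity 0 is the only root of f - f(0), and this polynomial splits. -/
theorem eq_C_mul_X_pow_add_C_of_injective [IsAlgClosed K] {f : K[X]}
    (hf : Function.Injective fun x => f.eval x) (hd : f.natDegree ≠ 0) :
    f = C f.leadingCoeff * X ^ f.natDegree + C (f.eval 0) := by
  set g := f - C (f.eval 0) with hg
  have hgd : g.natDegree = f.natDegree := natDegree_sub_C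
  have hgl : g.leadingCoeff = f.leadingCoeff := by
    rw [leadingCoeff, hgd, hg, coeff_sub, coeff_C, if_neg hd, sub_zero, leadingCoeff]
  have hroots : g.roots = Multiset.replicate f.natDegree 0 := by
    rw [Multiset.eq_replicate, ← hgd]
    refine ⟨(IsAlgClosed.splits g).natDegree_eq_card_roots.symm, fun x hx => hf ?_⟩
    have := isRoot_of_mem_roots hx
    simpa [hg, sub_eq_zero] using this
  have h := (IsAlgClosed.splits g).eq_prod_roots
  rw [hroots, hgl] at h
  simp only [Multiset.map_replicate, C_0, sub_zero, Multiset.prod_replicate] at h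
  rw [← h, hg, sub_add_cancel]

variable {E : WeierstrassCurve K} [DecidableEq K] [IsAlgClosed K] [E.IsShortNF] [E.IsElliptic]

/-- An injective endomorphism is given on `x`-coordinates by a polynomial `cxⁿ + d`. -/
theorem exists_xCoord_of_injective {φ : endRing E} (hinj : ∀ P, φ.1 P = 0 → P = 0) :
    ∃ c d : K, c ≠ 0 ∧ ∀ x y (h : E.toAffine.Nonsingular x y), ∃ y' h',
      φ.1 (.some x y h) = .some (c * x ^ deg φ + d) y' h' := by
  obtain ⟨v, hv, hφ⟩ := exists_isXRep_deg φ
  have hdeg : deg φ ≠ 0 := by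
    intro h0
    obtain ⟨y, hy⟩ := exists_affine_point (E := E) 0
    have := hinj (.some 0 y hy) (by rw [eq_zero_of_deg_eq_zero h0]; rfl)
    simp at this
  -- A zero of the denominator would put an affine point into the kernel.
  have hφ0 : ∀ x y (h : E.toAffine.Nonsingular x y), (v 1).eval x ≠ 0 := by
    intro x y h h1
    have hx := hφ x y h
    obtain ⟨i, hi⟩ := hv.exists_eval_ne_zero x
    have h0 : (v 0).eval x ≠ 0 := by
      fin_cases i
      · exact hi
      · exact (hi h1).elim
    rw [h1, zero_mul, mul_eq_zero, or_iff_right h0] at hx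
    rcases hR : φ.1 (.some x y h) with _ | ⟨x', y', h'⟩
    · simpa using hinj _ hR
    · simp [hR] at hx
  have hv1 : (v 1).degree = 0 := by
    by_contra hd
    obtain ⟨x, hx⟩ := IsAlgClosed.exists_root _ hd
    obtain ⟨y, hy⟩ := exists_affine_point (E := E) x
    exact hφ0 x y hy hx
  obtain ⟨e, he⟩ : ∃ e, v 1 = C e := ⟨_, eq_C_of_degree_eq_zero hv1⟩
  have he0 : e ≠ 0 := by
    rintro rfl
    simp [he] at hv1
  have hv0 : (v 0).natDegree = deg φ := by
    refine le_antisymm (hv.natDegree_le 0) (le_natDegree_of_ne_zero ?_)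
    obtain ⟨i, hi⟩ := hv.exists_coeff_ne_zero
    fin_cases i
    · exact hi
    · simp [he, coeff_C, hdeg] at hi
  set f := C e⁻¹ * v 0 with hf
  have hfd : f.natDegree = deg φ := by rw [hf, natDegree_C_mul (inv_ne_zero he0), hv0]
  have hx : ∀ x y (h : E.toAffine.Nonsingular x y), ∃ y' h',
      φ.1 (.some x y h) = .some (f.eval x) y' h' := by
    intro x y h
    have hx := hφ x y h
    rcases hR : φ.1 (.some x y h) with _ | ⟨x', y', h'⟩
    · exact absurd (hinj _ hR) (by simp)
    · rw [hR] at hx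
      simp [he] at hx
      have : x' = f.eval x := by
        rw [hf, eval_mul, eval_C, hx]
        field_simp
      subst this
      exact ⟨y', h', rfl⟩
  have hfinj : Function.Injective fun x => f.eval x := by
    intro x₁ x₂ h12
    obtain ⟨y₁, h₁⟩ := exists_affine_point (E := E) x₁
    obtain ⟨y₂, h₂⟩ := exists_affine_point (E := E) x₂
    obtain ⟨y₁', h₁', e₁⟩ := hx x₁ y₁ h₁
    obtain ⟨y₂', h₂', e₂⟩ := hx x₂ y₂ h₂
    have hrep : (φ.1 (.some x₁ y₁ h₁)).xRep = (φ.1 (.some x₂ y₂ h₂)).xRep := by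
      rw [e₁, e₂, Affine.Point.xRep_some, Affine.Point.xRep_some]
      simpa using h12
    rcases Affine.Point.eq_or_eq_neg_of_xRep_eq_xRep hrep with h | h
    · have := hinj (.some x₁ y₁ h₁ - .some x₂ y₂ h₂) (by rw [map_sub, h, sub_self])
      exact (Affine.Point.some.inj (sub_eq_zero.mp this)).1
    · have := hinj (.some x₁ y₁ h₁ + .some x₂ y₂ h₂) (by rw [map_add, h, neg_add_cancel])
      exact (Affine.Point.some.inj (eq_neg_of_add_eq_zero_left this)).1
  have hform := eq_C_mul_X_pow_add_C_of_injective hfinj (hfd ▸ hdeg)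
  refine ⟨f.leadingCoeff, f.eval 0, ?_, fun x y h => ?_⟩
  · rw [leadingCoeff_ne_zero]
    rintro h0
    rw [h0, natDegree_zero] at hfd
    exact hdeg hfd.symm
  · obtain ⟨y', h', hval⟩ := hx x y h
    have : f.eval x = f.leadingCoeff * x ^ deg φ + f.eval 0 := by
      conv_lhs => rw [hform]
      simp [hfd]
    exact this ▸ ⟨y', h', hval⟩

/-- An injective endomorphism of degree a power of the characteristic is given on `x`-coordinates by
`cx^q`, and its coefficient `c` relates the Weierstrass equation to its `q`-Frobenius twist. -/
theorem exists_xCoord_eq_mul_pow {p : ℕ} [Fact p.Prime] [CharP K p] (hp : 3 < p) {φ : endRing E}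
    (hinj : ∀ P, φ.1 P = 0 → P = 0) {k : ℕ} (hdeg : deg φ = p ^ k) :
    ∃ c : K, c ≠ 0 ∧ (∀ x y (h : E.toAffine.Nonsingular x y), ∃ y' h',
      φ.1 (.some x y h) = .some (c * x ^ p ^ k) y' h') ∧
      E.a₄ = c ^ 2 * E.a₄ ^ p ^ k ∧ E.a₆ = c ^ 3 * E.a₆ ^ p ^ k := by
  obtain ⟨c, d, hc, hx⟩ := exists_xCoord_of_injective hinj
  rw [hdeg] at hx
  have hq : 0 < p ^ k := pow_pos (Fact.out : p.Prime).pos k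
  obtain ⟨γ, hγ⟩ := IsAlgClosed.exists_pow_nat_eq c hq
  obtain ⟨δ, hδ⟩ := IsAlgClosed.exists_pow_nat_eq d hq
  obtain ⟨α, hα⟩ := IsAlgClosed.exists_pow_nat_eq E.a₄ hq
  obtain ⟨β, hβ⟩ := IsAlgClosed.exists_pow_nat_eq E.a₆ hq
  have hγ0 : γ ≠ 0 := by
    rintro rfl
    rw [zero_pow hq.ne'] at hγ
    exact hc hγ.symm
  -- The coefficients are those of (γx + δ)³ + α(γx + δ) + β, the q-th root of the cubic at cx^q + d
  -- (q = p^k). Passing to the root keeps degree 3, so G can be compared with the cubic itself.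
  set G := Cubic.toPoly ⟨γ ^ 3, 3 * γ ^ 2 * δ, 3 * γ * δ ^ 2 + α * γ, δ ^ 3 + α * δ + β⟩ with hG
  have hGeval : ∀ x, G.eval x ^ p ^ k = (cubic E).eval (c * x ^ p ^ k + d) := by
    intro x
    have : G.eval x = (γ * x + δ) ^ 3 + α * (γ * x + δ) + β := by
      simp [hG, Cubic.toPoly]; ring
    rw [this, add_pow_char_pow, add_pow_char_pow, mul_pow, ← pow_mul, mul_comm 3, pow_mul,
      add_pow_char_pow, mul_pow, hγ, hδ, hα, hβ, eval_cubic]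
  have h2 := two_ne_zero_of_isElliptic E
  -- Roots of the cubic are x-coordinates of 2-torsion points, which φ sends to 2-torsion points.
  have hroot : ∀ x, (cubic E).eval x = 0 → G.eval x = 0 := by
    intro x h0
    have hxy : E.toAffine.Nonsingular x 0 := Affine.equation_iff_nonsingular.mp
      (equation_iff_of_isShortNF.mpr (by rw [h0]; simp))
    obtain ⟨y', h', e⟩ := hx x 0 hxy
    have hneg : (.some x 0 hxy : E.toAffine.Point) = -.some x 0 hxy := by
      simp [Affine.Point.neg_some]
    have hy : y' = -y' := by
      have h1 := congrArg φ.1 hneg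
      rw [map_neg, e, Affine.Point.neg_some] at h1
      have := (Affine.Point.some.inj h1).2
      rwa [negY_of_isShortNF] at this
    have hy0 : y' = 0 := by
      have : 2 * y' = 0 := by linear_combination hy
      exact (mul_eq_zero.mp this).resolve_left h2
    have heq := equation_iff_of_isShortNF.mp h'.1
    rw [hy0, ← hGeval] at heq
    exact (pow_eq_zero_iff hq.ne').mp (by rw [← heq]; simp)
  have hG0 : G ≠ 0 := Cubic.ne_zero_of_a_ne_zero (pow_ne_zero 3 hγ0)
  have hdvd : cubic E ∣ G := by
    refine (IsAlgClosed.splits _).dvd_of_roots_le_roots (cubic_ne_zero E) ?_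
    rw [Multiset.le_iff_subset (nodup_roots (cubic_separable E))]
    intro x hx
    exact (mem_roots hG0).mpr (hroot x (isRoot_of_mem_roots hx))
  obtain ⟨h, hh⟩ := hdvd
  have hh0 : h ≠ 0 := by
    rintro rfl
    exact hG0 (by simpa using hh)
  have hhd : h.natDegree = 0 := by
    have h1 := congrArg natDegree hh
    rw [natDegree_mul (cubic_ne_zero E) hh0, cubic_natDegree, hG,
      Cubic.natDegree_of_a_ne_zero (pow_ne_zero 3 hγ0)] at h1
    omega
  obtain ⟨e, he⟩ : ∃ e, h = C e := ⟨_, eq_C_of_natDegree_eq_zero hhd⟩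
  have hcub : cubic E * C e = Cubic.toPoly ⟨e, 0, e * E.a₄, e * E.a₆⟩ := by
    simp [cubic, Cubic.toPoly]; ring
  rw [he, hcub, hG] at hh
  have hcoeff := (Cubic.toPoly_injective _ _).mp hh
  simp only [Cubic.mk.injEq] at hcoeff
  obtain ⟨k1, k2, k3, k4⟩ := hcoeff
  have h3 : (3 : K) ≠ 0 := by
    intro h0
    have : (p : ℕ) ∣ 3 := (CharP.cast_eq_zero_iff K p 3).mp (by exact_mod_cast h0)
    exact absurd (Nat.le_of_dvd (by norm_num) this) (by omega)
  -- G is a scalar multiple of the cubic, which has no x² term; here 3 must be invertible.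
  have hδ0 : δ = 0 := by simpa [h3, hγ0] using k2
  have hd0 : d = 0 := by rw [← hδ, hδ0, zero_pow hq.ne']
  have hα' : α = γ ^ 2 * E.a₄ := by
    refine mul_left_cancel₀ hγ0 ?_
    rw [hδ0] at k3
    linear_combination k3 - E.a₄ * k1
  have hβ' : β = γ ^ 3 * E.a₆ := by
    rw [hδ0] at k4
    linear_combination k4 - E.a₆ * k1
  refine ⟨c, hc, fun x y h => ?_, ?_, ?_⟩
  · obtain ⟨y', h', hval⟩ := hx x y h
    have : c * x ^ p ^ k + d = c * x ^ p ^ k := by rw [hd0, add_zero]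
    exact this ▸ ⟨y', h', hval⟩
  · conv_lhs => rw [← hα, hα', mul_pow, ← pow_mul, mul_comm 2, pow_mul, hγ]
  · conv_lhs => rw [← hβ, hβ', mul_pow, ← pow_mul, mul_comm 3, pow_mul, hγ]

end Injective

/-! ### Frobenius on a supersingular curve over the prime field. -/

section Frobenius

/-- A group is not the union of two proper subgroups, here the kernels of f - g and f + g. This
upgrades equality of x-coordinates to equality of endomorphisms up to one global sign. -/
theorem eq_or_eq_neg_of_forall {A B : Type*} [AddCommGroup A] [AddCommGroup B] {f g : A →+ B}
    (h : ∀ x, f x = g x ∨ f x = -g x) : f = g ∨ f = -g := by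
  by_contra! hne
  obtain ⟨x, hx⟩ := DFunLike.ne_iff.mp hne.1
  obtain ⟨y, hy⟩ := DFunLike.ne_iff.mp hne.2
  have hx' : f x = -g x := (h x).resolve_left hx
  have hy' : f y = g y := (h y).resolve_right hy
  rcases h (x + y) with h' | h'
  · rw [map_add, map_add, hy'] at h'
    exact hx (add_right_cancel h')
  · rw [map_add, map_add, hx', neg_add] at h'
    exact hy (add_left_cancel h')

variable {p : ℕ} [Fact p.Prime] {K : Type*} [Field K] [DecidableEq K] [Algebra (ZMod p) K]

variable (K) in
/-- The Frobenius endomorphism `(x, y) ↦ (x^p, y^p)` of a curve defined over the prime field. -/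
noncomputable def frobHom (E₀ : WeierstrassCurve (ZMod p)) :
    AddMonoid.End (E₀.baseChange K).toAffine.Point :=
  Affine.Point.map (W' := E₀.toAffine) (FiniteField.frobeniusAlgHom (ZMod p) K)

theorem frobHom_some (E₀ : WeierstrassCurve (ZMod p)) {x y : K}
    (h : (E₀.baseChange K).toAffine.Nonsingular x y) :
    ∃ h', frobHom K E₀ (.some x y h) = .some (x ^ p) (y ^ p) h' := by
  have hf : ∀ z : K, FiniteField.frobeniusAlgHom (ZMod p) K z = z ^ p := fun z => by
    simp [ZMod.card]
  have e : frobHom K E₀ (.some x y h) = .some _ _ _ :=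
    Affine.Point.map_some (W' := E₀.toAffine) (FiniteField.frobeniusAlgHom (ZMod p) K) h
  simp only [hf] at e
  exact ⟨_, e⟩

theorem isMorphism_frobHom (E₀ : WeierstrassCurve (ZMod p)) : IsMorphism (frobHom K E₀) := by
  intro P
  have hp : p ≠ 0 := (Fact.out : p.Prime).ne_zero
  have key : ∀ Q : (E₀.baseChange K).toAffine.Point, (fun i => MvPolynomial.eval (coords Q)
      ((MvPolynomial.X i ^ p : MvPolynomial (Fin 3) K))) = (1 : K) • coords (frobHom K E₀ Q) := by
    rintro (_ | ⟨x, y, hxy⟩)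
    · rw [← Affine.Point.zero_def, map_zero, coords_zero]
      ext i
      fin_cases i <;> simp [hp]
    · obtain ⟨h', e⟩ := frobHom_some E₀ hxy
      rw [e, coords_some, coords_some]
      ext i
      fin_cases i <;> simp
  refine ⟨p, _, fun i => MvPolynomial.isHomogeneous_X_pow i p, ?_, fun Q => ⟨1, key Q⟩⟩
  obtain ⟨i, hi⟩ := coords_ne_zero (frobHom K E₀ P)
  exact ⟨i, by rw [congrFun (key P) i]; simpa using hi⟩

variable [IsAlgClosed K]

variable (K) in
/-- The Frobenius endomorphism as an element of the endomorphism ring. -/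
noncomputable def frob (E₀ : WeierstrassCurve (ZMod p)) [(E₀.baseChange K).IsElliptic] :
    endRing (E₀.baseChange K) :=
  ⟨frobHom K E₀, isMorphism_frobHom E₀⟩

theorem deg_frob (E₀ : WeierstrassCurve (ZMod p)) [(E₀.baseChange K).IsElliptic]
    [(E₀.baseChange K).IsShortNF] : deg (frob K E₀) = p := by
  refine deg_eq_of_isXRep (w := ![Polynomial.X ^ p, 1])
    ⟨fun i => ?_, fun x => ⟨1, by simp⟩, 0, by simp⟩ ?_
  · fin_cases i <;> simp
  · intro x y h
    obtain ⟨h', e⟩ := frobHom_some E₀ h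
    change _ * (frobHom K E₀ (.some x y h)).xRep 1 = _ * (frobHom K E₀ (.some x y h)).xRep 0
    rw [e]
    simp

theorem natCast_endRing_apply {E : WeierstrassCurve K} [E.IsElliptic] (n : ℕ)
    (P : E.toAffine.Point) : (n : endRing E).1 P = n • P := by
  rw [show (n : endRing E).1 = ((n : AddMonoid.End E.toAffine.Point)) from
    map_natCast (endRing E).subtype n]
  rfl

theorem deg_natCast {E : WeierstrassCurve K} [E.IsElliptic] [E.IsShortNF] (n : ℕ) :
    deg (n : endRing E) = n ^ 2 := by
  have := deg_intCast (E := E) n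
  rw [Int.cast_natCast] at this
  exact_mod_cast this

/-- On a supersingular curve over the prime field, multiplication by `p` is the square of the
Frobenius followed by an endomorphism. -/
theorem exists_mul_frob_mul_frob (hp : 3 < p) (E₀ : WeierstrassCurve (ZMod p))
    [(E₀.baseChange K).IsElliptic] [(E₀.baseChange K).IsShortNF]
    (hE : IsSupersingular p (E₀.baseChange K)) :
    ∃ ρ : endRing (E₀.baseChange K), ρ * frob K E₀ * frob K E₀ = p := by
  have hchar : CharP K p := charP_of_injective_algebraMap' (ZMod p) p
  set W := E₀.baseChange K with hW
  obtain ⟨c, hc, hx, h4, h6⟩ := exists_xCoord_eq_mul_pow hp (φ := (p : endRing W))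
    (fun P hP => hE P (by rwa [natCast_endRing_apply] at hP)) (deg_natCast p)
  have hfix : ∀ a : ZMod p, algebraMap (ZMod p) K a ^ p ^ 2 = algebraMap (ZMod p) K a := by
    intro a
    rw [pow_two, pow_mul, ← map_pow, ← map_pow, ZMod.pow_card, ZMod.pow_card]
  have e4 : W.a₄ = algebraMap (ZMod p) K E₀.a₄ := rfl
  have e6 : W.a₆ = algebraMap (ZMod p) K E₀.a₆ := rfl
  rw [show W.a₄ ^ p ^ 2 = W.a₄ by rw [e4, hfix]] at h4
  rw [show W.a₆ ^ p ^ 2 = W.a₆ by rw [e6, hfix]] at h6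
  -- Since a₄ and a₆ are fixed by the p²-power map, a₄ = γ⁴a₄ and a₆ = γ⁶a₆ with γ² = c. So scaling
  -- by γ is an automorphism whose effect on x is multiplication by c.
  obtain ⟨γ, hγ⟩ := IsAlgClosed.exists_pow_nat_eq c two_pos
  have hγ0 : γ ≠ 0 := by
    rintro rfl
    exact hc (by rw [← hγ]; simp)
  let D : VariableChange K := ⟨Units.mk0 γ hγ0, 0, 0, 0⟩
  have hD : D • W = W := by
    have k4 : γ⁻¹ ^ 4 * W.a₄ = W.a₄ := by
      rw [← hγ] at h4
      conv_lhs => rw [h4]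
      field_simp
    have k6 : γ⁻¹ ^ 6 * W.a₆ = W.a₆ := by
      rw [← hγ] at h6
      conv_lhs => rw [h6]
      field_simp
    ext
    · simp [variableChange_a₁, D]
    · simp [variableChange_a₂, D]
    · simp [variableChange_a₃, D]
    · simpa [variableChange_a₄, D] using k4
    · simpa [variableChange_a₆, D] using k6
  let ρ : endRing W := ⟨variableChangeHom hD, isMorphism_variableChangeHom hD⟩
  have key : ∀ P, (p : endRing W).1 P = (ρ * frob K E₀ * frob K E₀).1 P ∨
      (p : endRing W).1 P = -(ρ * frob K E₀ * frob K E₀).1 P := by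
    rintro (_ | ⟨x, y, h⟩)
    · left
      rw [← Affine.Point.zero_def, map_zero, map_zero]
    · refine Affine.Point.eq_or_eq_neg_of_xRep_eq_xRep ?_
      obtain ⟨y', h', e⟩ := hx x y h
      obtain ⟨h₁, e₁⟩ := frobHom_some E₀ h
      obtain ⟨h₂, e₂⟩ := frobHom_some E₀ h₁
      have e₃ : (ρ * frob K E₀ * frob K E₀).1 (.some x y h) =
        variableChangeHom hD (frobHom K E₀ (frobHom K E₀ (.some x y h))) := rfl
      rw [e, e₃, e₁, e₂, variableChangeHom_some, Affine.Point.xRep_some, Affine.Point.xRep_some]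
      simp only [D, Units.val_mk0, add_zero, hγ, pow_two p, pow_mul]
  rcases eq_or_eq_neg_of_forall key with h | h
  · exact ⟨ρ, Subtype.ext h.symm⟩
  · refine ⟨-ρ, Subtype.ext ?_⟩
    rw [neg_mul, neg_mul]
    exact h.symm

theorem frob_mul_self (hp : 3 < p) (E₀ : WeierstrassCurve (ZMod p))
    [(E₀.baseChange K).IsElliptic] [(E₀.baseChange K).IsShortNF]
    (hE : IsSupersingular p (E₀.baseChange K)) : frob K E₀ * frob K E₀ = -p := by
  have hprime : p.Prime := Fact.out
  have hp0 : (p : ℤ) ≠ 0 := by exact_mod_cast hprime.ne_zero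
  obtain ⟨ρ, hρ⟩ := exists_mul_frob_mul_frob hp E₀ hE
  set π := frob K E₀
  have hπ : deg π = p := deg_frob E₀
  have hρ1 : deg ρ = 1 := by
    have h := congrArg deg hρ
    rw [deg_mul, deg_mul, deg_natCast, hπ, mul_assoc, ← pow_two] at h
    exact Nat.eq_of_mul_eq_mul_right (pow_pos hprime.pos 2) (by rw [h, one_mul])
  have hchar := mul_self_sub_trace_add_norm
    (N := fun φ : endRing (E₀.baseChange K) => (deg φ : ℤ))
    (fun φ ψ => by exact_mod_cast deg_add_add_deg_sub φ ψ)
    (fun φ ψ => by exact_mod_cast deg_mul φ ψ) (by simp [deg_one])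
    (fun φ h => eq_zero_of_deg_eq_zero (by exact_mod_cast h)) π
  simp only [hπ] at hchar
  set a : ℤ := deg (π + 1) - p - 1 with ha
  -- The characteristic equation π² - aπ + p = 0 with p replaced by ρπ². Multiplicativity of the
  -- degree then cancels the right factor π.
  have hprod : ((1 + ρ) * π - (a : endRing (E₀.baseChange K))) * π = 0 := by
    rw [zsmul_eq_mul, zsmul_eq_mul, mul_one, Int.cast_natCast, ← hρ] at hchar
    rw [← hchar]
    noncomm_ring
  have hlin : (1 + ρ) * π = a := by
    have h := congrArg deg hprod
    rw [deg_mul, deg_zero, hπ] at h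
    exact sub_eq_zero.mp (eq_zero_of_deg_eq_zero
      ((mul_eq_zero.mp h).resolve_right hprime.ne_zero))
  have hsq : (deg (1 + ρ) : ℤ) * p = a ^ 2 := by
    rw [← deg_intCast (E := E₀.baseChange K), ← hlin, deg_mul, hπ]
    push_cast
    rfl
  -- The parallelogram law: deg(1 + ρ) + deg(1 - ρ) = 4.
  have hle : deg (1 + ρ) ≤ 4 := by
    have h := deg_add_add_deg_sub 1 ρ
    rw [deg_one, hρ1] at h
    omega
  have hdvd : (p : ℤ) ∣ a := Int.Prime.dvd_pow' hprime (Dvd.intro_left _ hsq)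
  have hdvd' : p ∣ deg (1 + ρ) := by
    obtain ⟨b, hb⟩ := hdvd
    have : (deg (1 + ρ) : ℤ) = p * b ^ 2 := by
      refine mul_right_cancel₀ hp0 ?_
      rw [hsq, hb]
      ring
    exact_mod_cast Dvd.intro _ this.symm
  have hdeg : deg (1 + ρ) = 0 := by
    by_contra h0
    have h1 := Nat.le_of_dvd (Nat.pos_of_ne_zero h0) hdvd'
    -- A positive multiple of p that is at most 4, with p > 3, leaves only the composite p = 4.
    have h4 : p = 4 := by omega
    rw [h4] at hprime
    exact absurd hprime (by norm_num)
  have hρneg : ρ = -1 := (neg_eq_of_add_eq_zero_right (eq_zero_of_deg_eq_zero hdeg)).symm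
  rw [hρneg, neg_one_mul, neg_mul] at hρ
  rw [← hρ, neg_neg]

end Frobenius

/-! ### From -p being a square of an endomorphism to both sides of the equivalence. -/

section Main

variable {p : ℕ} [Fact p.Prime] {K : Type*} [Field K] [IsAlgClosed K]

/-- The roots of X^p - X are exactly the prime field, so j descends. The standard curve `ofJ j` then
has the same j-invariant as E, hence is isomorphic to it over K. -/
theorem isDefinedOver_of_j_pow_eq [Algebra (ZMod p) K] {E : WeierstrassCurve K} [E.IsElliptic]
    (h : E.j ^ p = E.j) :
    IsDefinedOver (ZMod p) E := by
  have hchar : CharP K p := charP_of_injective_algebraMap' (ZMod p) p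
  obtain ⟨j, hj⟩ : ∃ j : ZMod p, algebraMap (ZMod p) K j = E.j :=
    (bot_le : ⊥ ≤ (algebraMap (ZMod p) K).fieldRange) ((Subfield.mem_bot_iff_pow_eq_self K p).mpr h)
  have hell : ((ofJ j).baseChange K).IsElliptic :=
    inferInstanceAs ((ofJ j).map (algebraMap (ZMod p) K)).IsElliptic
  obtain ⟨C, hC⟩ := exists_variableChange_of_j_eq ((ofJ j).baseChange K) E (by
    rw [← hj]
    conv_rhs => rw [← ofJ_j j]
    exact map_j _ _)
  exact ⟨ofJ j, C, inferInstance, hC⟩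

variable [DecidableEq K]

/-- An endomorphism with square `-p` gives an embedding of `ℤ[√-p]`. -/
theorem exists_injective_of_mul_self_eq_neg {E : WeierstrassCurve K} [E.IsElliptic] [E.IsShortNF]
    {α : endRing E} (hα : α * α = -(p : endRing E)) :
    ∃ ι : ℤ√(-(p : ℤ)) →+* endRing E, Function.Injective ι := by
  have hp : 0 < (p : ℤ) := by exact_mod_cast (Fact.out : p.Prime).pos
  have hcomm : ∀ n : ℤ, α * n = n * α := fun n => (Int.cast_commute n α).eq.symm
  let ι : ℤ√(-(p : ℤ)) →+* endRing E :=
    { toFun := fun z => z.re + z.im * α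
      map_one' := by simp
      map_zero' := by simp
      map_add' := fun z w => by
        simp only [Zsqrtd.re_add, Zsqrtd.im_add, Int.cast_add]
        noncomm_ring
      map_mul' := fun z w => by
        have h : ((z.re : endRing E) + z.im * α) * (w.re + w.im * α) =
            z.re * w.re + z.im * w.im * (α * α) + (z.re * w.im + z.im * w.re) * α := by
          have h1 : (z.im : endRing E) * α * w.re = z.im * w.re * α := by
            rw [mul_assoc, hcomm, mul_assoc]
          have h2 : (z.im : endRing E) * α * (w.im * α) = z.im * w.im * (α * α) := by
            rw [mul_assoc, ← mul_assoc α, hcomm, mul_assoc, mul_assoc]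
          rw [mul_add, add_mul, add_mul, h1, h2]
          noncomm_ring
        rw [h, hα]
        simp only [Zsqrtd.re_mul, Zsqrtd.im_mul]
        push_cast
        rw [show (z.im : endRing E) * w.im * -(p : endRing E) = -p * z.im * w.im by
          rw [mul_neg, neg_mul, neg_mul, ← (Nat.cast_commute p _).eq, mul_assoc]] }
  refine ⟨ι, (injective_iff_map_eq_zero ι).mpr fun z hz => ?_⟩
  -- The norm of z is an integer killed by ι; as deg n = n², that integer is 0, and the form re² +
  -- p·im² is positive definite.
  have h1 : ι (z * star z) = 0 := by rw [map_mul, hz, zero_mul]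
  have h2 : z * star z = ((z.re * z.re + p * (z.im * z.im) : ℤ) : ℤ√(-(p : ℤ))) := by
    ext <;> simp <;> ring
  rw [h2, map_intCast] at h1
  have h3 := deg_intCast (E := E) (z.re * z.re + p * (z.im * z.im))
  rw [h1, deg_zero] at h3
  have h4 : z.re * z.re + p * (z.im * z.im) = 0 := by
    simpa using h3.symm
  have h5 : z.im = 0 := by nlinarith [mul_self_nonneg z.re, mul_self_nonneg z.im]
  have h6 : z.re = 0 := by
    rw [h5] at h4
    simpa using h4
  exact Zsqrtd.ext h6 h5

variable [Algebra (ZMod p) K]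

/-- The relations a₄ = c²a₄^p and a₆ = c³a₆^p say that E is a twist of its own Frobenius conjugate.
Both a₄³ and 4a₄³ + 27a₆² pick up the factor c⁶, which cancels in j. -/
theorem isDefinedOver_of_mul_self_eq_neg (hp : 3 < p) {E : WeierstrassCurve K} [E.IsElliptic]
    [E.IsShortNF] (hE : IsSupersingular p E) {α : endRing E} (hα : α * α = -(p : endRing E)) :
    IsDefinedOver (ZMod p) E := by
  have hprime : p.Prime := Fact.out
  have hchar : CharP K p := charP_of_injective_algebraMap' (ZMod p) p
  have hdeg : deg α = p ^ 1 := by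
    have h := congrArg deg hα
    rw [deg_mul, deg_neg, deg_natCast, pow_two] at h
    rw [pow_one]
    exact Nat.mul_self_inj.mp h
  have hinj : ∀ P, α.1 P = 0 → P = 0 := by
    intro P hP
    refine hE P ?_
    have h1 : (α * α).1 P = 0 := by
      change α.1 (α.1 P) = 0
      rw [hP, map_zero]
    rw [hα] at h1
    change -((p : endRing E).1 P) = 0 at h1
    rwa [natCast_endRing_apply, neg_eq_zero] at h1
  obtain ⟨c, hc, -, h4, h6⟩ := exists_xCoord_eq_mul_pow hp hinj hdeg
  rw [pow_one] at h4 h6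
  refine isDefinedOver_of_j_pow_eq ?_
  have hΔ := right_ne_zero_of_mul (discr_ne_zero E)
  have hfix : ∀ n : ℕ, (n : K) ^ p = n := fun n => by
    have := map_pow (algebraMap (ZMod p) K) (n : ZMod p) p
    rw [ZMod.pow_card, map_natCast] at this
    exact this.symm
  have hΔp : (4 * E.a₄ ^ 3 + 27 * E.a₆ ^ 2) ^ p = 4 * (E.a₄ ^ p) ^ 3 + 27 * (E.a₆ ^ p) ^ 2 := by
    rw [add_pow_char, mul_pow, mul_pow, show (4 : K) ^ p = 4 from hfix 4,
      show (27 : K) ^ p = 27 from hfix 27, ← pow_mul, ← pow_mul, mul_comm 3, mul_comm 2, pow_mul,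
      pow_mul]
  have hΔ' : 4 * E.a₄ ^ 3 + 27 * E.a₆ ^ 2 = c ^ 6 * (4 * E.a₄ ^ 3 + 27 * E.a₆ ^ 2) ^ p := by
    rw [hΔp]
    conv_lhs => rw [h4, h6]
    ring
  rw [j_of_isShortNF, div_pow, mul_pow, show (6912 : K) ^ p = 6912 from hfix 6912,
    div_eq_div_iff (pow_ne_zero _ hΔ) hΔ]
  have h4' : (E.a₄ ^ 3 : K) = c ^ 6 * (E.a₄ ^ 3) ^ p := by
    conv_lhs => rw [h4]
    rw [mul_pow, ← pow_mul, ← pow_mul, ← pow_mul, mul_comm 3 p]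
  linear_combination 6912 * (E.a₄ ^ 3) ^ p * hΔ' -
    6912 * (4 * E.a₄ ^ 3 + 27 * E.a₆ ^ 2) ^ p * h4'

end Main

end EllCurve

theorem mainTheorem4 (p : ℕ) [Fact p.Prime] (hp : 3 < p)
    (K : Type*) [Field K] [DecidableEq K] [Algebra (ZMod p) K]
    [IsAlgClosed K] [Algebra.IsAlgebraic (ZMod p) K]
    (E : WeierstrassCurve K) [E.IsElliptic] (hE : EllCurve.IsSupersingular p E) :
    EllCurve.IsDefinedOver (ZMod p) E ↔
      ∃ ι : ℤ√(-(p : ℤ)) →+* EllCurve.endRing E, Function.Injective ι := by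
  have hprime : p.Prime := Fact.out
  have hchar : CharP K p := charP_of_injective_algebraMap' (ZMod p) p
  have hsmall : ∀ n : ℕ, 0 < n → n < p → (n : ZMod p) ≠ 0 := fun n h0 hn h => by
    rw [ZMod.natCast_eq_zero_iff] at h
    exact absurd (Nat.le_of_dvd h0 h) (by omega)
  have h2 : (2 : ZMod p) ≠ 0 := hsmall 2 (by norm_num) (by omega)
  have h3 : (3 : ZMod p) ≠ 0 := hsmall 3 (by norm_num) hp
  constructor
  · rintro ⟨E₀, u, hE₀, hu⟩
    let _ := invertibleOfNonzero h2
    let _ := invertibleOfNonzero h3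
    obtain ⟨C, hC⟩ := E₀.exists_variableChange_isShortNF
    set E₁ := C • E₀ with hE₁
    have hmap : C.map (algebraMap (ZMod p) K) • E₀.baseChange K = E₁.baseChange K :=
      WeierstrassCurve.map_variableChange _ _ _
    have hell : (E₁.baseChange K).IsElliptic :=
      inferInstanceAs (E₁.map (algebraMap (ZMod p) K)).IsElliptic
    have hshort : (E₁.baseChange K).IsShortNF := by
      constructor
      · change algebraMap (ZMod p) K E₁.a₁ = 0
        rw [E₁.a₁_of_isShortNF, map_zero]
      · change algebraMap (ZMod p) K E₁.a₂ = 0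
        rw [E₁.a₂_of_isShortNF, map_zero]
      · change algebraMap (ZMod p) K E₁.a₃ = 0
        rw [E₁.a₃_of_isShortNF, map_zero]
    -- Shortening the equation over the prime field keeps Frobenius available. This change over K
    -- then carries supersingularity from E to the short model and the embedding back to E.
    have hD : (u * (C.map (algebraMap (ZMod p) K))⁻¹) • E₁.baseChange K = E := by
      rw [← hmap, mul_smul, inv_smul_smul, hu]
    have hss := hE.of_variableChange (inv_smul_eq_iff.mpr hD.symm)
    obtain ⟨ι, hι⟩ := EllCurve.exists_injective_of_mul_self_eq_neg
      (EllCurve.frob_mul_self hp E₁ hss)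
    exact ⟨(EllCurve.endRingVariableChange hD).comp ι,
      (EllCurve.endRingVariableChange_injective hD).comp hι⟩
  · rintro ⟨ι, -⟩
    have h2' : (2 : K) ≠ 0 := by
      have := (map_ne_zero (algebraMap (ZMod p) K)).mpr h2
      rwa [map_ofNat] at this
    have h3' : (3 : K) ≠ 0 := by
      have := (map_ne_zero (algebraMap (ZMod p) K)).mpr h3
      rwa [map_ofNat] at this
    let _ := invertibleOfNonzero h2'
    let _ := invertibleOfNonzero h3'
    obtain ⟨C, hC⟩ := E.exists_variableChange_isShortNF
    -- The image of √-p, moved to the short model, is an endomorphism with square -p.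
    have hα := congrArg (EllCurve.endRingVariableChange (rfl : C • E = C • E))
      (congrArg ι (Zsqrtd.dmuld (d := -(p : ℤ))))
    simp only [map_mul, Int.cast_neg, Int.cast_natCast, map_neg, map_natCast] at hα
    obtain ⟨E₀, u, hE₀, hu⟩ := EllCurve.isDefinedOver_of_mul_self_eq_neg hp
      (hE.of_variableChange rfl) hα
    exact ⟨E₀, C⁻¹ * u, hE₀, by rw [mul_smul, hu, inv_smul_smul]⟩
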